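/- Let $G$ be a (finite-dimensional) complex Lie group acting holomorphically and properly on a (finite-dimensional, Hausdorff) complex manifold $M$; proper means that the map $G\times M\to M\times M$, $(g,y)\mapsto (gy,y)$, is proper. Let $x\in M$ be a point whose stabilizer $G_x=\{g\in G : gx=x\}$ is finite. Then there exists a subset $S\subset M$ containing $x$ with the following properties. 1. $S$ is a locally closed (embedded) complex submanifold of $M$, it is contractible, and it is $G_x$-invariant. 2. The set $GS=\{gs : g\in G,\ s\in S\}$ is open in $M$. Let $G\times^{G_x}S$ be the quotient of $G\times S$ by the action $h\cdot(g,s)=(gh^{-1},hs)$ of $G_x$, with the complex manifold structure for which the quotient map $G\times S\to G\times^{G_x}S$ is a local biholomorphism. Then the map $G\times^{G_x}S\to GS$, $[g,s]\mapsto gs$, is well defined and is an isomorphism of complex manifolds (a biholomorphism). 3. In particular, the map $G\times S\to GS$, $(g,s)\mapsto gs$, is a covering map of degree $|G_x|$: it is a covering map all of whose fibers have exactly $|G_x|$ elements. -/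

import Mathlib

open scoped Manifold ContDiff Topology

section TwistedProduct

variable {G M : Type*} [Group G] [MulAction G M] {H : Subgroup G}

/-- The orbit relation on `G × S` of the action `h • (g, s) = (g h⁻¹, h s)` of `H`, where `S` is an
`H`-invariant subset of `M` (that is, a `SubMulAction H M`). -/
def twistedSetoid (S : SubMulAction H M) : Setoid (G × S) where
  r p q := ∃ h : H, q = (p.1 * (h : G)⁻¹, h • p.2)
  iseqv :=
    { refl := fun p => ⟨1, by simp⟩
      symm := by
        rintro p _ ⟨h, rfl⟩
        exact ⟨h⁻¹, by simp⟩
      trans := by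
        rintro p _ _ ⟨h, rfl⟩ ⟨k, rfl⟩
        exact ⟨k * h, by simp [mul_assoc, mul_smul]⟩ }

/-- The twisted product `G ×^H S`, the quotient of `G × S` by `H`. -/
def TwistedProduct (S : SubMulAction H M) : Type _ := Quotient (twistedSetoid S)

/-- The quotient map `G × S → G ×^H S`. -/
def TwistedProduct.mk (S : SubMulAction H M) (p : G × S) : TwistedProduct S :=
  Quotient.mk (twistedSetoid S) p

/-- The set `GS = {g s | g ∈ G, s ∈ S}`. -/
def saturation (S : SubMulAction H M) : Set M := {y | ∃ g : G, ∃ s ∈ S, g • s = y}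

/-- The action map `G × S → GS`, `(g, s) ↦ g s`. -/
def toSaturation (S : SubMulAction H M) (p : G × S) : saturation S :=
  ⟨p.1 • (p.2 : M), p.1, p.2, p.2.2, rfl⟩

/-- The quotient topology on `G ×^H S`. -/
instance TwistedProduct.instTopologicalSpace [TopologicalSpace G] [TopologicalSpace M]
    (S : SubMulAction H M) : TopologicalSpace (TwistedProduct S) :=
  TopologicalSpace.coinduced (TwistedProduct.mk S) inferInstance

theorem TwistedProduct.mk_surjective (S : SubMulAction H M) :
    Function.Surjective (TwistedProduct.mk S) := Quotient.mk_surjective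

theorem TwistedProduct.mk_eq_mk_iff (S : SubMulAction H M) (p q : G × S) :
    TwistedProduct.mk S p = TwistedProduct.mk S q ↔
      ∃ h : H, q = (p.1 * (h : G)⁻¹, h • p.2) :=
  Quotient.eq (r := twistedSetoid S)

theorem TwistedProduct.isOpenMap_mk [TopologicalSpace G] [IsTopologicalGroup G]
    [TopologicalSpace M] [ContinuousConstSMul G M] (S : SubMulAction H M) :
    IsOpenMap (TwistedProduct.mk S) := by
  intro U hU
  change IsOpen (TwistedProduct.mk S ⁻¹' (TwistedProduct.mk S '' U))
  have key : TwistedProduct.mk S ⁻¹' (TwistedProduct.mk S '' U) =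
      ⋃ h : H, (fun p : G × S => ((p.1 * (h : G)⁻¹, h • p.2) : G × S)) ⁻¹' U := by
    ext p
    simp only [Set.mem_preimage, Set.mem_image, Set.mem_iUnion]
    constructor
    · rintro ⟨q, hq, hqp⟩
      obtain ⟨h, rfl⟩ := (TwistedProduct.mk_eq_mk_iff S p q).1 hqp.symm
      exact ⟨h, hq⟩
    · rintro ⟨h, hh⟩
      exact ⟨_, hh, ((TwistedProduct.mk_eq_mk_iff S p _).2 ⟨h, rfl⟩).symm⟩
  rw [key]
  refine isOpen_iUnion fun h => hU.preimage ?_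
  refine (continuous_fst.mul continuous_const).prodMk ?_
  refine Continuous.subtype_mk ?_ _
  exact (continuous_const_smul (h : G)).comp (continuous_subtype_val.comp continuous_snd)

/-- For a finite subgroup `H` the quotient map `G × S → G ×^H S` is a local homeomorphism. -/
theorem TwistedProduct.isLocalHomeomorph_mk [TopologicalSpace G] [IsTopologicalGroup G]
    [T2Space G] [TopologicalSpace M] [ContinuousConstSMul G M] [Finite H]
    (S : SubMulAction H M) : IsLocalHomeomorph (TwistedProduct.mk S) := by
  rw [isLocalHomeomorph_iff_isOpenEmbedding_restrict]
  rintro ⟨g, s⟩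
  have hW : IsOpen ((H : Set G) \ {1})ᶜ :=
    ((Set.toFinite (H : Set G)).subset Set.sdiff_subset).isClosed.isOpen_compl
  have hT : IsOpen ((fun p : G × G => p.1⁻¹ * p.2) ⁻¹' ((H : Set G) \ {1})ᶜ) :=
    hW.preimage (continuous_fst.inv.mul continuous_snd)
  obtain ⟨V, V', hV, hV', hgV, hgV', hVV⟩ := isOpen_prod_iff.1 hT g g (by simp)
  have hopen : IsOpen ((V ∩ V') ×ˢ (Set.univ : Set S)) := (hV.inter hV').prod isOpen_univ
  refine ⟨(V ∩ V') ×ˢ Set.univ, hopen.mem_nhds ⟨⟨hgV, hgV'⟩, trivial⟩, ?_⟩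
  refine Topology.IsOpenEmbedding.of_continuous_injective_isOpenMap ?_ ?_ ?_
  · exact continuous_coinduced_rng.comp continuous_subtype_val
  · rintro ⟨p, hp⟩ ⟨q, hq⟩ hpq
    obtain ⟨h, rfl⟩ := (TwistedProduct.mk_eq_mk_iff S p q).1 hpq
    have hmem := hVV (Set.mk_mem_prod hp.1.1 hq.1.2)
    have h1 : h = 1 := by
      by_contra hne
      apply hmem
      refine ⟨by simp, ?_⟩
      simpa using hne
    subst h1
    simp
  · exact (TwistedProduct.isOpenMap_mk S).comp hopen.isOpenMap_subtype_val

/-- The charts of `G ×^H S` for a finite subgroup `H` of a complex Lie group `G`: local inverses of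
the quotient map `G × S → G ×^H S` followed by charts of `G × S`. -/
noncomputable instance TwistedProduct.instChartedSpace
    {EG F : Type*} [NormedAddCommGroup EG] [NormedSpace ℂ EG] [TopologicalSpace F]
    [TopologicalSpace G] [ChartedSpace EG G] [LieGroup 𝓘(ℂ, EG) ω G] [T2Space G]
    [TopologicalSpace M] [ContinuousConstSMul G M] [Finite H]
    (S : SubMulAction H M) [ChartedSpace F S] :
    ChartedSpace (ModelProd EG F) (TwistedProduct S) :=
  haveI : IsTopologicalGroup G := topologicalGroup_of_lieGroup 𝓘(ℂ, EG) ω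
  (TwistedProduct.isLocalHomeomorph_mk S).chartedSpace (TwistedProduct.mk_surjective S)

end TwistedProduct

/-! ### Local diffeomorphisms and charts -/

section LocalDiffeomorph

open Set Filter

variable {𝕜 : Type*} [NontriviallyNormedField 𝕜]
  {E : Type*} [NormedAddCommGroup E] [NormedSpace 𝕜 E]
  {F : Type*} [NormedAddCommGroup F] [NormedSpace 𝕜 F]
  {H : Type*} [TopologicalSpace H] {H' : Type*} [TopologicalSpace H']
  {I : ModelWithCorners 𝕜 E H} {J : ModelWithCorners 𝕜 F H'}
  {M : Type*} [TopologicalSpace M] [ChartedSpace H M]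
  {N : Type*} [TopologicalSpace N] [ChartedSpace H' N] {n : WithTop ℕ∞}

/-! The slice is built linearly in a chart adapted to the stabilizer `H` of `x`. Averaging an
arbitrary chart over the finite group `H` makes it equivariant for a linear representation
(`exists_linearizing_chart`). Since `H` is finite, the orbit map `g ↦ g • x` has injective
derivative at `1` (`injective_mfderiv_smul`): a tangent vector in the kernel would integrate to a
nonconstant curve inside `H`. The image `W` of this derivative is `H`-invariant, so it has an
invariant complement `F` (`exists_isCompl_invariant`). The slice `S` corresponds in the chart to a
small convex invariant piece of `F`.

Because `W ⊕ F` is the whole tangent space, the inverse function theorem makes `(g, w) ↦ g • e.symm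
w` a local biholomorphism at `(1, 0)` (`exists_transversal_chart`). Left translation extends this to
every point of `G × S` (`isLocalDiffeomorph_smul_of_chart`).

Properness makes the local picture global. If `g` moves a point of `S` into `S`, then `g = v h` with
`h ∈ H` and `v` close to `1` (`exists_nhds_forall_smul_mem`). As `h` preserves `S`, injectivity of
the action map near `(1, 0)` forces `v = 1`, so `g ∈ H`. The induced map from the twisted product is
therefore injective, and a bijective local biholomorphism is a biholomorphism. The covering
statement follows because the quotient by the finite group `H`, which acts freely on `G × S`, is
itself a covering. -/

theorem IsLocalDiffeomorphAt.congr_of_eventuallyEq {f g : M → N} {x : M}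
    (hf : IsLocalDiffeomorphAt I J n f x) (h : g =ᶠ[𝓝 x] f) :
    IsLocalDiffeomorphAt I J n g x := by
  obtain ⟨Φ, hx, heq⟩ := hf
  obtain ⟨U, hU, hUo, hxU⟩ := eventually_nhds_iff.1 h
  let e := Φ.toOpenPartialHomeomorph.restrOpen U hUo
  have hes : e.source = Φ.source ∩ U := rfl
  refine ⟨⟨e.toPartialEquiv, e.open_source, e.open_target,
    Φ.contMDiffOn_toFun.mono fun y hy => hy.1,
    Φ.contMDiffOn_invFun.mono fun y hy => hy.1⟩, ⟨hx, hxU⟩,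
    fun y hy => (hU y hy.2).trans (heq hy.1)⟩

/-- An open partial homeomorphism which is `C^n` near `x`, with inverse `C^n` near the image of `x`,
is a local diffeomorphism at `x`. -/
theorem OpenPartialHomeomorph.isLocalDiffeomorphAt (e : OpenPartialHomeomorph M N) {x : M}
    (hx : x ∈ e.source) (h : ∀ᶠ y in 𝓝 x, ContMDiffAt I J n e y)
    (h' : ∀ᶠ y in 𝓝 (e x), ContMDiffAt J I n e.symm y) :
    IsLocalDiffeomorphAt I J n e x := by
  obtain ⟨U, hU, hUo, hxU⟩ := eventually_nhds_iff.1
    (h.and ((e.continuousAt hx).eventually h'))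
  let e' := e.restrOpen U hUo
  refine ⟨⟨e'.toPartialEquiv, e'.open_source, e'.open_target,
    fun y hy => (hU y hy.2).1.contMDiffWithinAt, fun y hy => ?_⟩, ⟨hx, hxU⟩, fun y hy => rfl⟩
  have hz := e'.map_target hy
  have := (hU _ hz.2).2
  have h2 : e (e'.symm y) = y := e'.right_inv hy
  rw [h2] at this
  exact this.contMDiffWithinAt

/-- The inverse of a local diffeomorphism, as an open partial homeomorphism, is a local
diffeomorphism. -/
theorem OpenPartialHomeomorph.isLocalDiffeomorphAt_symm (e : OpenPartialHomeomorph M N) {x : M}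
    (hx : x ∈ e.source) (h : IsLocalDiffeomorphAt I J n e x) :
    IsLocalDiffeomorphAt J I n e.symm (e x) := by
  refine h.localInverse_isLocalDiffeomorphAt.congr_of_eventuallyEq ?_
  have hc : ContinuousAt e.symm (e x) := e.symm.continuousAt (e.map_source hx)
  have ht : h.localInverse.target ∈ 𝓝 (e.symm (e x)) := by
    rw [e.left_inv hx]
    exact h.localInverse.open_target.mem_nhds h.localInverse_mem_target
  filter_upwards [hc.preimage_mem_nhds ht, e.open_target.mem_nhds (e.map_source hx)] with y hy hy'
  have := h.localInverse_left_inv hy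
  rwa [e.right_inv hy', eq_comm] at this

section Chart

variable [I.Boundaryless] [IsManifold I n M]

/-- A chart of a manifold without boundary, as a local homeomorphism to the model vector space. -/
noncomputable def ModelWithCorners.extendChart (I : ModelWithCorners 𝕜 E H) [I.Boundaryless]
    (x : M) : OpenPartialHomeomorph M E :=
  (chartAt H x).trans I.toHomeomorph.toOpenPartialHomeomorph

omit [IsManifold I n M] in
theorem ModelWithCorners.extendChart_toPartialEquiv (x : M) :
    (I.extendChart x).toPartialEquiv = extChartAt I x := by
  ext <;> simp [extendChart, extChartAt, OpenPartialHomeomorph.extend]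

theorem isLocalDiffeomorphAt_extChartAt (x : M) :
    IsLocalDiffeomorphAt I 𝓘(𝕜, E) n (extChartAt I x) x := by
  refine (I.extendChart x).isLocalDiffeomorphAt ?_ ?_ ?_
  · rw [I.extendChart_toPartialEquiv]; exact mem_extChartAt_source x
  · filter_upwards [chart_source_mem_nhds H x] with y hy
    exact contMDiffAt_extChartAt' hy
  · filter_upwards [extChartAt_target_mem_nhds (I := I) x] with y hy
    exact (contMDiffOn_extChartAt_symm x).contMDiffAt
      ((isOpen_extChartAt_target x).mem_nhds hy)

theorem isLocalDiffeomorphAt_extChartAt_symm (x : M) :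
    IsLocalDiffeomorphAt 𝓘(𝕜, E) I n (extChartAt I x).symm (extChartAt I x x) := by
  refine (I.extendChart x).isLocalDiffeomorphAt_symm ?_ (isLocalDiffeomorphAt_extChartAt x)
  rw [I.extendChart_toPartialEquiv]; exact mem_extChartAt_source x

end Chart

end LocalDiffeomorph

/-! ### The inverse function theorem on manifolds -/

section InverseFunctionTheorem

open Set Filter

variable {𝕜 : Type*} [RCLike 𝕜]
  {E : Type*} [NormedAddCommGroup E] [NormedSpace 𝕜 E] [CompleteSpace E]
  {F : Type*} [NormedAddCommGroup F] [NormedSpace 𝕜 F] [CompleteSpace F]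
  {H : Type*} [TopologicalSpace H] {H' : Type*} [TopologicalSpace H']
  {I : ModelWithCorners 𝕜 E H} {J : ModelWithCorners 𝕜 F H'} [I.Boundaryless] [J.Boundaryless]
  {M : Type*} [TopologicalSpace M] [ChartedSpace H M]
  {N : Type*} [TopologicalSpace N] [ChartedSpace H' N] {n : WithTop ℕ∞}
  [IsManifold I n M] [IsManifold J n N]

/-- The **inverse function theorem** on manifolds without boundary. -/
theorem ContMDiffAt.isLocalDiffeomorphAt {f : M → N} {x : M} (hn : n ≠ 0) (hn' : n ≠ ∞)
    (hf : ContMDiffAt I J n f x) (hbij : Function.Bijective (mfderiv I J f x)) :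
    IsLocalDiffeomorphAt I J n f x := by
  let D : E →L[𝕜] F := mfderiv I J f x
  let D' : E ≃L[𝕜] F := ContinuousLinearEquiv.ofBijective D
    (LinearMap.ker_eq_bot.2 hbij.1) (LinearMap.range_eq_top.2 hbij.2)
  have hD' : (D' : E →L[𝕜] F) = D := ContinuousLinearEquiv.coe_ofBijective _ _ _
  let g := writtenInExtChartAt I J x f
  have hg : ContDiffAt 𝕜 n g (extChartAt I x x) := by
    have := (contMDiffAt_iff.1 hf).2
    rwa [I.range_eq_univ, contDiffWithinAt_univ] at this
  have hgd : HasFDerivAt g (D' : E →L[𝕜] F) (extChartAt I x x) := by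
    have : HasFDerivWithinAt g D (range I) (extChartAt I x x) :=
      (hf.mdifferentiableAt hn).hasMFDerivAt.2
    rwa [hD', ← hasFDerivWithinAt_univ, ← I.range_eq_univ]
  let e := hg.toOpenPartialHomeomorph g hgd hn
  have he : IsLocalDiffeomorphAt 𝓘(𝕜, E) 𝓘(𝕜, F) n g (extChartAt I x x) := by
    refine e.isLocalDiffeomorphAt (hg.mem_toOpenPartialHomeomorph_source hgd hn) ?_ ?_
    -- Being `C^n` at a point spreads to a neighbourhood unless `n = ∞`; this is the role of `hn'`.
    · exact (hg.eventually hn').mono fun y hy => hy.contMDiffAt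
    · exact ((hg.to_localInverse hgd hn).eventually hn').mono fun y hy => hy.contMDiffAt
  have hgx : g (extChartAt I x x) = extChartAt J (f x) (f x) := by
    simp [g, writtenInExtChartAt]
  have h1 := (isLocalDiffeomorphAt_extChartAt (I := I) (n := n) x).comp (K := 𝓘(𝕜, F)) (P := F) he
  have h2 := h1.comp (g := (extChartAt J (f x)).symm) (K := J) (P := N) (by
    rw [Function.comp_apply, hgx]
    exact isLocalDiffeomorphAt_extChartAt_symm (f x))
  refine h2.congr_of_eventuallyEq ?_
  filter_upwards [extChartAt_source_mem_nhds (I := I) x,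
    hf.continuousAt.preimage_mem_nhds (extChartAt_source_mem_nhds (I := J) (f x))] with y hy hy'
  simp only [Function.comp_apply, g, writtenInExtChartAt]
  rw [(extChartAt I x).left_inv hy, (extChartAt J (f x)).left_inv hy']

end InverseFunctionTheorem

/-! ### Manifold structure on the base of a local homeomorphism -/

section LocalHomeomorphQuotient

open Set Filter

variable {𝕜 : Type*} [NontriviallyNormedField 𝕜]
  {E : Type*} [NormedAddCommGroup E] [NormedSpace 𝕜 E]
  {F : Type*} [NormedAddCommGroup F] [NormedSpace 𝕜 F]
  {H : Type*} [TopologicalSpace H] {H' : Type*} [TopologicalSpace H']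
  {I : ModelWithCorners 𝕜 E H} {J : ModelWithCorners 𝕜 F H'}
  {X : Type*} [TopologicalSpace X] [ChartedSpace H X]
  {Y : Type*} [TopologicalSpace Y]
  {Z : Type*} [TopologicalSpace Z] [ChartedSpace H' Z] {n : WithTop ℕ∞}
  {f : X → Y} {a : X → Z} {Φ : Y → Z}

omit [TopologicalSpace Y] in
/-- If a local diffeomorphism factors through a local homeomorphism `f`, then a continuous map that
does not change the value of `f` is smooth. -/
theorem IsLocalDiffeomorph.contMDiffAt_of_factor (ha : IsLocalDiffeomorph I J n a)
    (hΦ : ∀ p, Φ (f p) = a p) {τ : X → X} {p : X} (hτ : ContinuousAt τ p)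
    (h : ∀ᶠ y in 𝓝 p, f (τ y) = f y) : ContMDiffAt I I n τ p := by
  -- Near `p` one has `a ∘ τ = a`, so `τ` is `a` followed by the local inverse of `a` at `τ p`.
  have hap : a (τ p) = a p := by rw [← hΦ, ← hΦ, h.self_of_nhds]
  have h1 := (ha (τ p)).localInverse_contMDiffAt
  rw [hap] at h1
  refine (h1.comp p (ha p).contMDiffAt).congr_of_eventuallyEq ?_
  filter_upwards [h, hτ.preimage_mem_nhds ((ha (τ p)).localInverse.open_target.mem_nhds
    (ha (τ p)).localInverse_mem_target)] with y hy hy'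
  have := (ha (τ p)).localInverse_left_inv hy'
  rw [Function.comp_apply, ← hΦ y, ← hy, hΦ, this]

variable [IsManifold I n X]

omit [IsManifold I n X] in
-- These maps are local deck transformations of `f`; all transition maps of the quotient atlas are
-- made from them.
theorem IsLocalHomeomorph.contMDiffOn_localInverseAt_comp (hf : IsLocalHomeomorph f)
    (ha : IsLocalDiffeomorph I J n a) (hΦ : ∀ p, Φ (f p) = a p) (p : X) :
    ContMDiffOn I I n (hf.localInverseAt p ∘ f) (f ⁻¹' (hf.localInverseAt p).source) := by
  intro y hy
  refine (ha.contMDiffAt_of_factor hΦ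
    (((hf.localInverseAt p).continuousAt hy).comp hf.continuous.continuousAt)
    ?_).contMDiffWithinAt
  filter_upwards [((hf.localInverseAt p).open_source.preimage hf.continuous).mem_nhds hy] with z hz
  exact hf.apply_localInverseAt_of_mem hz

/-- Up to charts of `X`, a change of charts of `Y` is a local deck transformation of `f`, and these
are smooth because `a` factors through `f`. For the twisted product, this replaces a separate proof
that the finite group acts holomorphically on the slice. -/
theorem IsLocalHomeomorph.isManifold_chartedSpace (hf : IsLocalHomeomorph f)
    (hs : Function.Surjective f) (ha : IsLocalDiffeomorph I J n a) (hΦ : ∀ p, Φ (f p) = a p) :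
    letI := hf.chartedSpace (H := H) hs
    IsManifold I n Y := by
  let := hf.chartedSpace (H := H) hs
  have key : ∀ p q : X, ContMDiffOn I I n ((hf.localInverseAt p).symm.trans (hf.localInverseAt q))
      ((hf.localInverseAt p).symm.trans (hf.localInverseAt q)).source := by
    intro p q
    have h := hf.contMDiffOn_localInverseAt_comp ha hΦ q
    rw [OpenPartialHomeomorph.coe_trans, hf.localInverseAt_symm]
    refine h.mono fun y hy => ?_
    simpa using hy.2
  have hG : HasGroupoid Y (contDiffGroupoid n I) := by
    constructor
    rintro _ _ ⟨q, rfl⟩ ⟨q', rfl⟩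
    set p := hs.hasRightInverse.choose q
    set p' := hs.hasRightInverse.choose q'
    have hc : chartAt H p ∈ IsManifold.maximalAtlas I n X :=
      IsManifold.chart_mem_maximalAtlas p
    have hc' : chartAt H p' ∈ IsManifold.maximalAtlas I n X :=
      IsManifold.chart_mem_maximalAtlas p'
    have hτ : ((hf.localInverseAt p).symm.trans (hf.localInverseAt p')).trans (chartAt H p') ∈
        IsManifold.maximalAtlas I n X := by
      refine OpenPartialHomeomorph.mem_maximalAtlas_of_contMDiffOn _ ?_ ?_
      · exact (contMDiffOn_of_mem_maximalAtlas hc').comp ((key p p').mono fun y hy => hy.1)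
          fun y hy => hy.2
      · exact (key p' p).comp ((contMDiffOn_symm_of_mem_maximalAtlas hc').mono inter_subset_left)
          fun y hy => hy.2
    -- Regrouping turns the transition map into one between two charts of `X`, the second being the
    -- chart at `p'` pulled back by a deck transformation.
    rw [OpenPartialHomeomorph.trans_symm_eq_symm_trans_symm, OpenPartialHomeomorph.trans_assoc,
      ← OpenPartialHomeomorph.trans_assoc (hf.localInverseAt p).symm]
    exact (contDiffGroupoid n I).compatible_of_mem_maximalAtlas hc hτ
  exact IsManifold.mk' I n Y

/-- At the chosen preimage `r q`, both `f` and its local inverse are the identity in charts. Deck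
transformations carry this to all other preimages. -/
theorem IsLocalHomeomorph.isLocalDiffeomorph_chartedSpace (hf : IsLocalHomeomorph f)
    (hs : Function.Surjective f) (ha : IsLocalDiffeomorph I J n a) (hΦ : ∀ p, Φ (f p) = a p) :
    letI := hf.chartedSpace (H := H) hs
    IsLocalDiffeomorph I I n f := by
  let := hf.chartedSpace (H := H) hs
  have hM : IsManifold I n Y := hf.isManifold_chartedSpace hs ha hΦ
  obtain ⟨r, hchart, hright⟩ : ∃ r : Y → X,
      (∀ q, chartAt H q = (hf.localInverseAt (r q)).trans (chartAt H (r q))) ∧ ∀ q, f (r q) = q :=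
    ⟨_, fun _ => rfl, hs.hasRightInverse.choose_spec⟩
  have hσ : ∀ q : Y, hf.localInverseAt (r q) q =
      r q := fun q => by
    conv_lhs => rw [← hright q]
    rw [hright q]
    exact (congrArg _ (hright q).symm).trans hf.localInverseAt_apply_self
  have h1 : ∀ q : Y, ContMDiffAt I I n f (r q) := by
    intro q
    have hq : chartAt H (r q) (r q) =
        chartAt H q q := by
      rw [hchart q, OpenPartialHomeomorph.coe_trans, Function.comp_apply, hσ]
    have h3 : ContMDiffAt I I n (chartAt H q).symm
        (chartAt H (r q) (r q)) := by
      rw [hq]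
      exact contMDiffOn_chart_symm.contMDiffAt ((chartAt H q).open_target.mem_nhds
        (mem_chart_target H q))
    refine (h3.comp _ (contMDiffOn_chart.contMDiffAt
      (chart_source_mem_nhds H (r q)))).congr_of_eventuallyEq ?_
    filter_upwards [chart_source_mem_nhds H (r q)] with y hy
    rw [hchart q, OpenPartialHomeomorph.trans_symm_eq_symm_trans_symm,
      OpenPartialHomeomorph.coe_trans, hf.localInverseAt_symm, Function.comp_apply,
      Function.comp_apply, (chartAt H (r q)).left_inv hy]
  have h2 : ∀ q : Y, ContMDiffAt I I n (hf.localInverseAt (r q)) q := by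
    intro q
    have hq : chartAt H (r q) (r q) =
        chartAt H q q := by
      rw [hchart q, OpenPartialHomeomorph.coe_trans, Function.comp_apply, hσ]
    have h3 : ContMDiffAt I I n (chartAt H (r q)).symm
        (chartAt H q q) := by
      rw [← hq]
      exact contMDiffOn_chart_symm.contMDiffAt ((chartAt H _).open_target.mem_nhds
        (mem_chart_target H _))
    refine (h3.comp _ (contMDiffOn_chart.contMDiffAt
      (chart_source_mem_nhds H q))).congr_of_eventuallyEq ?_
    filter_upwards [chart_source_mem_nhds H q] with y hy
    rw [hchart q] at hy ⊢
    rw [Function.comp_apply, OpenPartialHomeomorph.coe_trans, Function.comp_apply,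
      (chartAt H (r q)).left_inv (show hf.localInverseAt (r q) y ∈ _ from hy.2)]
  intro p
  refine ⟨⟨(hf.localInverseAt p).symm.toPartialEquiv, (hf.localInverseAt p).open_target,
    (hf.localInverseAt p).open_source, fun y hy => ?_, fun y hy => ?_⟩,
    hf.self_mem_localInverseAt_target, fun y hy => ?_⟩
  · suffices h : ContMDiffAt I I n f y by
      have h4 : (hf.localInverseAt p).symm.toPartialEquiv.toFun = f := hf.localInverseAt_symm p
      rw [h4]
      exact h.contMDiffWithinAt
    have hmem : f y ∈ (hf.localInverseAt (r (f y))).source := by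
      have := hf.apply_self_mem_localInverseAt_source (x := r (f y))
      rwa [hright] at this
    have h3 := (hf.contMDiffOn_localInverseAt_comp ha hΦ _).contMDiffAt
      (((hf.localInverseAt (r (f y))).open_source.preimage
        hf.continuous).mem_nhds hmem)
    have h4 := h1 (f y)
    rw [← hσ (f y)] at h4
    refine (h4.comp (f := hf.localInverseAt (r (f y)) ∘ f)
      y h3).congr_of_eventuallyEq ?_
    filter_upwards [((hf.localInverseAt (r (f y))).open_source.preimage
        hf.continuous).mem_nhds hmem] with z hz
    exact (hf.apply_localInverseAt_of_mem hz).symm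
  · have hmem : y ∈ (hf.localInverseAt (r y)).source := by
      have := hf.apply_self_mem_localInverseAt_source (x := r y)
      rwa [hright] at this
    have h3 := (hf.contMDiffOn_localInverseAt_comp ha hΦ p).contMDiffAt
      (x := hf.localInverseAt (r y) y)
      (((hf.localInverseAt p).open_source.preimage hf.continuous).mem_nhds (by
        rw [mem_preimage, hσ, hright]; exact hy))
    refine ((h3.comp y (h2 y)).congr_of_eventuallyEq ?_).contMDiffWithinAt
    filter_upwards [(hf.localInverseAt (r y)).open_source.mem_nhds hmem]
      with z hz
    exact congrArg (hf.localInverseAt p) (hf.apply_localInverseAt_of_mem hz).symm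
  · exact congrFun (hf.localInverseAt_symm p).symm y

theorem IsLocalHomeomorph.isLocalDiffeomorph_factor_chartedSpace (hf : IsLocalHomeomorph f)
    (hs : Function.Surjective f) (ha : IsLocalDiffeomorph I J n a) (hΦ : ∀ p, Φ (f p) = a p) :
    letI := hf.chartedSpace (H := H) hs
    IsLocalDiffeomorph I J n Φ := by
  let := hf.chartedSpace (H := H) hs
  have hfd : IsLocalDiffeomorph I I n f := hf.isLocalDiffeomorph_chartedSpace hs ha hΦ
  intro q
  obtain ⟨p, rfl⟩ := hs q
  have h1 := (hfd p).localInverse_isLocalDiffeomorphAt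
  have hp : (hfd p).localInverse (f p) = p :=
    (hfd p).localInverse_left_inv (hfd p).localInverse_mem_target
  have h2 := h1.comp (g := a) (K := J) (P := Z) (by rw [hp]; exact ha p)
  refine h2.congr_of_eventuallyEq ?_
  filter_upwards [(hfd p).localInverse_eventuallyEq_right] with y hy
  rw [Function.comp_apply, ← hΦ]
  exact congrArg Φ hy.symm

end LocalHomeomorphQuotient

/-! ### Immersivity of the orbit map -/

section OrbitMap

open Set Filter

/-- Let `m` be a local multiplication with unit `e`, and let `F` be a map that intertwines the left
translations by elements near `e` with differentiable maps. If the derivative of `F` at `e` kills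
`v`, then `F` is constant on a curve through `e` with velocity `v`. -/
theorem exists_curve_of_fderiv_apply_eq_zero
    {E : Type*} [NormedAddCommGroup E] [NormedSpace ℂ E] [CompleteSpace E]
    {E' : Type*} [NormedAddCommGroup E'] [NormedSpace ℂ E'] {m : E → E → E} {F : E → E'} {e v : E}
    (hm : ContDiffAt ℂ ω (Function.uncurry m) (e, e)) (hme : ∀ᶠ w in 𝓝 e, m e w = w)
    (hme' : ∀ᶠ z in 𝓝 e, m z e = z) (hF : ContDiffAt ℂ ω F e)
    (hB : ∀ᶠ z in 𝓝 e, ∃ B : E' → E', DifferentiableAt ℂ B (F e) ∧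
      ∀ᶠ w in 𝓝 e, F (m z w) = B (F w)) (hv : fderiv ℂ F e v = 0) :
    ∃ γ : ℝ → E, γ 0 = e ∧ HasDerivAt γ v 0 ∧ ∀ᶠ t in 𝓝 0, F (γ t) = F e := by
  -- `V` is the left-invariant vector field with value `v` at `e`.
  let V : E → E := fun z => fderiv ℂ (m z) e v
  have hV : ContDiffAt ℝ 1 V e := by
    have : ContDiffAt ℂ 1 (fun z => fderiv ℂ (m z) e) e :=
      ContDiffAt.fderiv (n := ω) (g := fun _ => e) hm contDiffAt_const le_top
    exact (this.clm_apply contDiffAt_const).restrict_scalars ℝ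
  have hVe : V e = v := by
    have : fderiv ℂ (m e) e = fderiv ℂ id e := Filter.EventuallyEq.fderiv_eq hme
    simp [V, this]
  have hdm : ∀ᶠ z in 𝓝 e, DifferentiableAt ℂ (m z) e := by
    have h1 := hm.eventually (by simp)
    have h2 : Tendsto (fun z : E => (z, e)) (𝓝 e) (𝓝 (e, e)) :=
      (continuous_id.prodMk continuous_const).tendsto _
    filter_upwards [h2.eventually h1] with z hz
    exact (hz.comp (f := fun w => (z, w)) e (contDiffAt_const.prodMk contDiffAt_id)
      ).differentiableAt (by simp)
  have hdF : ∀ᶠ z in 𝓝 e, DifferentiableAt ℂ F z :=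
    (hF.eventually (by simp)).mono fun z hz => hz.differentiableAt (by simp)
  -- Differentiating `F ∘ m z = B ∘ F` at `e` in direction `v` carries the vanishing from `e` to
  -- `z`.
  have hkill : ∀ᶠ z in 𝓝 e, fderiv ℂ F z (V z) = 0 := by
    filter_upwards [hB, hdm, hdF, hme'] with z ⟨B, hBd, hBe⟩ hz hFz hze
    have hFz' : DifferentiableAt ℂ F (m z e) := by rwa [hze]
    have h1 : fderiv ℂ (F ∘ m z) e = fderiv ℂ (B ∘ F) e := Filter.EventuallyEq.fderiv_eq hBe
    rw [fderiv_comp _ hFz' hz, fderiv_comp _ hBd (hF.differentiableAt (by simp)), hze] at h1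
    have := DFunLike.congr_fun h1 v
    simpa [hv] using this
  -- Picard–Lindelöf gives an integral curve of `V`, along which `F` has zero derivative.
  obtain ⟨γ, hγ0, ε, hε, hγ⟩ :=
    hV.exists_forall_mem_closedBall_exists_eq_forall_mem_Ioo_hasDerivAt₀ 0
  have hd0 : HasDerivAt γ v 0 := by
    have := hγ 0 ⟨by linarith, by linarith⟩
    rwa [hγ0, hVe] at this
  refine ⟨γ, hγ0, hd0, ?_⟩
  have hγc : Tendsto γ (𝓝 0) (𝓝 e) := by
    have := hd0.continuousAt.tendsto
    rwa [hγ0] at this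
  obtain ⟨δ, hδ, hball⟩ := Metric.eventually_nhds_iff_ball.1
    ((hγc.eventually (hkill.and hdF)).and (Ioo_mem_nhds (by linarith : 0 - ε < 0)
      (by linarith : 0 < 0 + ε)))
  have hderiv : ∀ t ∈ Metric.ball (0 : ℝ) δ, HasDerivAt (F ∘ γ) 0 t := by
    intro t ht
    obtain ⟨⟨h1, h2⟩, h3⟩ := hball t ht
    have := (h2.hasFDerivAt.restrictScalars ℝ).comp_hasDerivAt t (hγ t h3)
    rwa [ContinuousLinearMap.coe_restrictScalars', h1] at this
  filter_upwards [Metric.ball_mem_nhds (0 : ℝ) hδ] with t ht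
  have := Metric.isOpen_ball.is_const_of_deriv_eq_zero (convex_ball (0 : ℝ) δ).isPreconnected
    (fun s hs => (hderiv s hs).differentiableAt.differentiableWithinAt)
    (fun s hs => (hderiv s hs).deriv) ht (Metric.mem_ball_self hδ)
  simpa [hγ0] using this

variable {EG : Type*} [NormedAddCommGroup EG] [NormedSpace ℂ EG] [CompleteSpace EG]
  {EM : Type*} [NormedAddCommGroup EM] [NormedSpace ℂ EM]
  {G : Type*} [Group G] [TopologicalSpace G] [T2Space G] [ChartedSpace EG G]
  [LieGroup 𝓘(ℂ, EG) ω G]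
  {M : Type*} [TopologicalSpace M] [ChartedSpace EM M] [IsManifold 𝓘(ℂ, EM) ω M]
  [MulAction G M] [ContMDiffSMul 𝓘(ℂ, EG) 𝓘(ℂ, EM) ω G M]

omit [CompleteSpace EG] [T2Space G] [LieGroup 𝓘(ℂ, EG) ω G] [IsManifold 𝓘(ℂ, EM) ω M] in
theorem contMDiff_smul_left (x : M) : ContMDiff 𝓘(ℂ, EG) 𝓘(ℂ, EM) ω (fun g : G => g • x) :=
  (contMDiff_smul (I := 𝓘(ℂ, EG)) (I' := 𝓘(ℂ, EM))).comp (contMDiff_id.prodMk contMDiff_const)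

/-- The derivative of the orbit map of a point with finite stabilizer is injective. -/
theorem injective_mfderiv_smul (x : M) [Finite (MulAction.stabilizer G x)] :
    Function.Injective (mfderiv 𝓘(ℂ, EG) 𝓘(ℂ, EM) (fun g : G => g • x) 1) := by
  have : IsTopologicalGroup G := topologicalGroup_of_lieGroup 𝓘(ℂ, EG) ω
  have : ContinuousSMul G M := ContMDiffSMul.continuousSMul (I := 𝓘(ℂ, EG)) (I' := 𝓘(ℂ, EM)) ω
  let φ := extChartAt 𝓘(ℂ, EG) (1 : G)
  let ψ := extChartAt 𝓘(ℂ, EM) ((1 : G) • x)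
  let e : EG := φ 1
  let F : EG → EM := fun z => ψ (φ.symm z • x)
  let m : EG → EG → EG := fun z w => φ (φ.symm z * φ.symm w)
  have hφe : φ.symm e = 1 := extChartAt_to_inv 1
  have hφs : ContMDiffAt 𝓘(ℂ, EG) 𝓘(ℂ, EG) ω φ.symm e :=
    (isLocalDiffeomorphAt_extChartAt_symm (1 : G)).contMDiffAt
  have hφ : ContMDiffAt 𝓘(ℂ, EG) 𝓘(ℂ, EG) ω φ (1 : G) := contMDiffAt_extChartAt
  have hψ : ContMDiffAt 𝓘(ℂ, EM) 𝓘(ℂ, EM) ω ψ ((1 : G) • x) := contMDiffAt_extChartAt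
  have hψs : ContMDiffAt 𝓘(ℂ, EM) 𝓘(ℂ, EM) ω ψ.symm (ψ ((1 : G) • x)) :=
    (isLocalDiffeomorphAt_extChartAt_symm ((1 : G) • x)).contMDiffAt
  have hψx : ψ.symm (ψ ((1 : G) • x)) = (1 : G) • x := extChartAt_to_inv _
  have hFe : F e = ψ ((1 : G) • x) := by simp only [F, hφe]
  have hF : ContDiffAt ℂ ω F e := by
    rw [← contMDiffAt_iff_contDiffAt]
    have h1 : ContMDiffAt 𝓘(ℂ, EG) 𝓘(ℂ, EM) ω (fun z => φ.symm z • x) e :=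
      (contMDiff_smul_left x).contMDiffAt.comp e hφs
    exact ContMDiffAt.comp (g := ψ) e (by rw [hφe]; exact hψ) h1
  have hm : ContDiffAt ℂ ω (Function.uncurry m) (e, e) := by
    rw [← contMDiffAt_iff_contDiffAt]
    have h1 : ContMDiffAt 𝓘(ℂ, EG × EG) 𝓘(ℂ, EG) ω (fun p : EG × EG => φ.symm p.1) (e, e) :=
      ContMDiffAt.comp (g := φ.symm) (e, e) hφs contDiff_fst.contMDiff.contMDiffAt
    have h2 : ContMDiffAt 𝓘(ℂ, EG × EG) 𝓘(ℂ, EG) ω (fun p : EG × EG => φ.symm p.2) (e, e) :=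
      ContMDiffAt.comp (g := φ.symm) (e, e) hφs contDiff_snd.contMDiff.contMDiffAt
    exact ContMDiffAt.comp (g := φ) (e, e) (by simpa [hφe] using hφ) (h1.mul h2)
  have hA : ContDiffAt ℂ ω (fun p : EG × EM => ψ (φ.symm p.1 • ψ.symm p.2)) (e, F e) := by
    rw [← contMDiffAt_iff_contDiffAt]
    have h1 : ContMDiffAt 𝓘(ℂ, EG × EM) 𝓘(ℂ, EG) ω (fun p : EG × EM => φ.symm p.1) (e, F e) :=
      ContMDiffAt.comp (g := φ.symm) (e, F e) hφs contDiff_fst.contMDiff.contMDiffAt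
    have h2 : ContMDiffAt 𝓘(ℂ, EG × EM) 𝓘(ℂ, EM) ω (fun p : EG × EM => ψ.symm p.2) (e, F e) :=
      ContMDiffAt.comp (g := ψ.symm) (e, F e) (by rw [hFe]; exact hψs)
        contDiff_snd.contMDiff.contMDiffAt
    refine ContMDiffAt.comp (g := ψ) (e, F e) ?_ (h1.smul h2)
    change ContMDiffAt 𝓘(ℂ, EM) 𝓘(ℂ, EM) ω ψ (φ.symm e • ψ.symm (F e))
    rw [hφe, hFe, hψx, one_smul]
    simpa only [one_smul] using hψ
  have hφc : ContinuousAt φ.symm e := hφs.continuousAt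
  have hφsrc : ∀ᶠ z in 𝓝 e, φ.symm z ∈ φ.source := by
    refine hφc.preimage_mem_nhds ?_
    rw [hφe]
    exact extChartAt_source_mem_nhds (1 : G)
  have htgt : ∀ᶠ z in 𝓝 e, z ∈ φ.target := extChartAt_target_mem_nhds (1 : G)
  intro v v' hvv
  rw [← sub_eq_zero, ← map_sub] at hvv
  rw [← sub_eq_zero]
  set u : EG := v - v'
  have hv : fderiv ℂ F e u = 0 := by
    let D : EG →L[ℂ] EM := mfderiv 𝓘(ℂ, EG) 𝓘(ℂ, EM) (fun g : G => g • x) 1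
    have h1 : HasFDerivWithinAt F D (range 𝓘(ℂ, EG)) e :=
      ((contMDiff_smul_left x).mdifferentiableAt (by simp)).hasMFDerivAt.2
    rw [modelWithCornersSelf_coe, range_id, hasFDerivWithinAt_univ] at h1
    rw [h1.fderiv]
    exact hvv
  have hB : ∀ᶠ z in 𝓝 e, ∃ B : EM → EM, DifferentiableAt ℂ B (F e) ∧
      ∀ᶠ w in 𝓝 e, F (m z w) = B (F w) := by
    have h2 : Tendsto (fun z : EG => (z, F e)) (𝓝 e) (𝓝 (e, F e)) :=
      (continuous_id.prodMk continuous_const).tendsto _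
    filter_upwards [h2.eventually (hA.eventually (by simp)), hφsrc] with z hz hzs
    refine ⟨fun y => ψ (φ.symm z • ψ.symm y), (hz.comp (f := fun w => (z, w)) (F e)
      (contDiffAt_const.prodMk contDiffAt_id)).differentiableAt (by simp), ?_⟩
    have h3 : ∀ᶠ w in 𝓝 e, φ.symm z * φ.symm w ∈ φ.source := by
      refine (continuousAt_const.mul hφc).preimage_mem_nhds ?_
      change φ.source ∈ 𝓝 (φ.symm z * φ.symm e)
      rw [hφe, mul_one]
      exact (isOpen_extChartAt_source (1 : G)).mem_nhds hzs
    have h4 : ∀ᶠ w in 𝓝 e, φ.symm w • x ∈ ψ.source := by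
      refine (hφc.smul continuousAt_const).preimage_mem_nhds ?_
      change ψ.source ∈ 𝓝 (φ.symm e • x)
      rw [hφe]
      exact extChartAt_source_mem_nhds _
    filter_upwards [h3, h4] with w hw hw'
    simp only [F, m]
    rw [φ.left_inv hw, ψ.left_inv hw', mul_smul]
  obtain ⟨γ, hγ0, hγd, hγF⟩ := exists_curve_of_fderiv_apply_eq_zero hm
    (by filter_upwards [htgt] with w hw; simp only [m, hφe, one_mul]; exact φ.right_inv hw)
    (by filter_upwards [htgt] with w hw; simp only [m, hφe, mul_one]; exact φ.right_inv hw)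
    hF hB hv
  have hγc : Tendsto γ (𝓝 0) (𝓝 e) := by
    have := hγd.continuousAt.tendsto
    rwa [hγ0] at this
  have hφγ : Tendsto (fun t => φ.symm (γ t)) (𝓝 0) (𝓝 1) := by
    have := hφc.tendsto.comp hγc
    rwa [hφe] at this
  have hfix : ∀ᶠ t in 𝓝 0, φ.symm (γ t) ∈ MulAction.stabilizer G x := by
    have h4 : ∀ᶠ g in 𝓝 (1 : G), g • x ∈ ψ.source :=
      (continuous_id.smul continuous_const).continuousAt.preimage_mem_nhds
        (extChartAt_source_mem_nhds _)
    filter_upwards [hγF, hφγ.eventually h4] with t ht ht'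
    rw [hFe] at ht
    have := ψ.injOn ht' (mem_extChartAt_source _) ht
    rwa [one_smul] at this
  -- A finite subgroup of a Hausdorff group is discrete, so the curve, which lies in the stabilizer
  -- for small times, is locally constant at `1` and has velocity zero.
  have hne : ∀ᶠ g in 𝓝 (1 : G), g ∉ ((MulAction.stabilizer G x : Set G) \ {1}) :=
    ((Set.toFinite (MulAction.stabilizer G x : Set G)).subset
      sdiff_subset).isClosed.isOpen_compl.mem_nhds (by simp)
  have hγe : γ =ᶠ[𝓝 0] fun _ => e := by
    filter_upwards [hfix, hφγ.eventually hne, hγc.eventually htgt] with t h1 h2 h3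
    have h4 : φ.symm (γ t) = 1 := by
      by_contra h
      exact h2 ⟨h1, h⟩
    rw [← φ.right_inv h3, h4]
  exact (hγd.congr_of_eventuallyEq hγe.symm).unique (hasDerivAt_const 0 e)

end OrbitMap

/-! ### Invariant complements and linearization by averaging -/

section Linearization

open Set Filter

/-- **Maschke's theorem**: an invariant subspace of a finite group of linear maps has an invariant
complement. -/
theorem exists_isCompl_invariant {H : Type*} [Group H] [Finite H] {E : Type*} [AddCommGroup E]
    [Module ℂ E] (ρ : H →* Module.End ℂ E) (W : Submodule ℂ E) (hW : ∀ h, ∀ w ∈ W, ρ h w ∈ W) :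
    ∃ F : Submodule ℂ E, IsCompl W F ∧ ∀ h, ∀ w ∈ F, ρ h w ∈ F := by
  have := Fintype.ofFinite H
  obtain ⟨p, hp⟩ := W.subtype.exists_leftInverse_of_injective (by simp)
  -- Averaging the conjugates of a projection onto `W` yields an equivariant projection; its kernel
  -- is the complement.
  let P : Module.End ℂ E :=
    (Fintype.card H : ℂ)⁻¹ • ∑ h : H, ρ h * (W.subtype ∘ₗ p) * ρ h⁻¹
  have hPapply : ∀ v, P v = (Fintype.card H : ℂ)⁻¹ • ∑ h : H, ρ h (p (ρ h⁻¹ v) : E) := fun v => by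
    simp [P, LinearMap.sum_apply]
  have hPmem : ∀ v, P v ∈ W := fun v => by
    rw [hPapply]
    exact W.smul_mem _ (W.sum_mem fun h _ => hW h _ (p _).2)
  have hPW : ∀ w ∈ W, P w = w := fun w hw => by
    have h1 : ∀ h : H, ρ h (p (ρ h⁻¹ w) : E) = w := fun h => by
      have := LinearMap.congr_fun hp ⟨ρ h⁻¹ w, hW _ _ hw⟩
      simp only [LinearMap.comp_apply, Submodule.subtype_apply, LinearMap.id_apply] at this
      rw [this, ← Module.End.mul_apply, ← map_mul, mul_inv_cancel, map_one, Module.End.one_apply]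
    rw [hPapply, Finset.sum_congr rfl fun h _ => h1 h, Finset.sum_const, Finset.card_univ,
      ← Nat.cast_smul_eq_nsmul ℂ, smul_smul, inv_mul_cancel₀ (by simp), one_smul]
  have hcomm : ∀ k v, P (ρ k v) = ρ k (P v) := fun k v => by
    rw [hPapply, hPapply, map_smul, map_sum]
    congr 1
    rw [← Equiv.sum_comp (Equiv.mulLeft k)]
    refine Finset.sum_congr rfl fun h _ => ?_
    rw [Equiv.coe_mulLeft, map_mul, Module.End.mul_apply, ← Module.End.mul_apply (ρ (k * h)⁻¹),
      ← map_mul, mul_inv_rev, inv_mul_cancel_right]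
  refine ⟨LinearMap.ker P, ⟨?_, ?_⟩, fun h w hw => ?_⟩
  · rw [Submodule.disjoint_def]
    intro w hw hw'
    rw [← hPW w hw]
    exact hw'
  · rw [codisjoint_iff, eq_top_iff]
    intro v _
    rw [← add_sub_cancel (P v) v]
    refine Submodule.add_mem_sup (hPmem v) ?_
    rw [LinearMap.mem_ker, map_sub, hPW _ (hPmem v), sub_self]
  · rw [LinearMap.mem_ker] at hw ⊢
    rw [hcomm, hw, map_zero]

variable {E : Type*} [NormedAddCommGroup E] [NormedSpace ℂ E] [CompleteSpace E]
  {M : Type*} [TopologicalSpace M] [ChartedSpace E M] [IsManifold 𝓘(ℂ, E) ω M]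
  {H : Type*} [Group H] [Finite H] [MulAction H M]

/-- **Cartan's linearization theorem**: near a fixed point, the action of a finite group is linear
in a suitable chart. -/
theorem exists_linearizing_chart (hH : ∀ h : H, ContMDiff 𝓘(ℂ, E) 𝓘(ℂ, E) ω fun y : M => h • y)
    (x : M) (hx : ∀ h : H, h • x = x) :
    ∃ (ρ : H →* (E →L[ℂ] E)) (χ : M → E), (∀ h y, χ (h • y) = ρ h (χ y)) ∧ χ x = 0 ∧
      IsLocalDiffeomorphAt 𝓘(ℂ, E) 𝓘(ℂ, E) ω χ x := by
  have := Fintype.ofFinite H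
  let φ := extChartAt 𝓘(ℂ, E) x
  let τ : H → E → E := fun h z => φ (h • φ.symm z)
  have hφx : φ.symm (φ x) = x := extChartAt_to_inv x
  have hφs : ContMDiffAt 𝓘(ℂ, E) 𝓘(ℂ, E) ω φ.symm (φ x) :=
    (isLocalDiffeomorphAt_extChartAt_symm x).contMDiffAt
  have hφ : ContMDiffAt 𝓘(ℂ, E) 𝓘(ℂ, E) ω φ x := contMDiffAt_extChartAt
  have hτx : ∀ h, τ h (φ x) = φ x := fun h => by simp only [τ, hφx, hx]
  have hτ : ∀ h, ContDiffAt ℂ ω (τ h) (φ x) := fun h => by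
    rw [← contMDiffAt_iff_contDiffAt]
    exact ContMDiffAt.comp (g := φ) (φ x) (by rw [hφx, hx]; exact hφ)
      (((hH h).contMDiffAt).comp (φ x) hφs)
  have hτd : ∀ h, DifferentiableAt ℂ (τ h) (φ x) := fun h => (hτ h).differentiableAt (by simp)
  have htgt : ∀ᶠ z in 𝓝 (φ x), z ∈ φ.target := extChartAt_target_mem_nhds x
  let ρ : H →* (E →L[ℂ] E) :=
    { toFun := fun h => fderiv ℂ (τ h) (φ x)
      map_one' := by
        have h1 : τ 1 =ᶠ[𝓝 (φ x)] id := by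
          filter_upwards [htgt] with z hz
          simp only [τ, one_smul, id]
          exact φ.right_inv hz
        rw [h1.fderiv_eq, fderiv_id]
        rfl
      map_mul' := fun h k => by
        have h1 : τ (h * k) =ᶠ[𝓝 (φ x)] τ h ∘ τ k := by
          have h2 : ∀ᶠ z in 𝓝 (φ x), k • φ.symm z ∈ φ.source := by
            refine (ContinuousAt.comp (f := φ.symm) (hH k).continuous.continuousAt
              hφs.continuousAt).preimage_mem_nhds ?_
            rw [Function.comp_apply, hφx, hx]
            exact extChartAt_source_mem_nhds x
          filter_upwards [h2] with z hz
          simp only [τ, Function.comp_apply]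
          rw [φ.left_inv hz, mul_smul]
        rw [h1.fderiv_eq, fderiv_comp _ (by rw [hτx]; exact hτd h) (hτd k), hτx]
        rfl }
  have hρ : ∀ h, ρ h = fderiv ℂ (τ h) (φ x) := fun h => rfl
  -- Equivariance is a reindexing of the sum, so it holds on all of `M`, even where `φ` takes values
  -- outside its chart domain. In the chart `φ`, each summand has derivative `ρ h⁻¹ ∘ ρ h = id` at
  -- `φ x`, and so does the average.
  let χ : M → E := fun y => (Fintype.card H : ℂ)⁻¹ • ∑ h : H, ρ h⁻¹ (φ (h • y) - φ x)
  let X : E → E := fun z => (Fintype.card H : ℂ)⁻¹ • ∑ h : H, ρ h⁻¹ (τ h z - φ x)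
  have hXd : HasFDerivAt X (ContinuousLinearMap.id ℂ E) (φ x) := by
    have h1 : HasFDerivAt X ((Fintype.card H : ℂ)⁻¹ • ∑ h : H, (ρ h⁻¹).comp (ρ h)) (φ x) := by
      refine HasFDerivAt.const_smul (HasFDerivAt.fun_sum fun h _ => ?_) _
      exact (ρ h⁻¹).hasFDerivAt.comp (φ x) ((hτd h).hasFDerivAt.sub_const _)
    have h2 : ∀ h : H, (ρ h⁻¹).comp (ρ h) = ContinuousLinearMap.id ℂ E := fun h => by
      change ρ h⁻¹ * ρ h = 1
      rw [← map_mul, inv_mul_cancel, map_one]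
    rwa [Finset.sum_congr rfl fun h _ => h2 h, Finset.sum_const, Finset.card_univ,
      ← Nat.cast_smul_eq_nsmul ℂ, smul_smul, inv_mul_cancel₀ (by simp), one_smul] at h1
  have hXs : ContDiffAt ℂ ω X (φ x) := by
    refine ContDiffAt.const_smul _ (ContDiffAt.sum fun h _ => ?_)
    exact (ρ h⁻¹).contDiff.contDiffAt.comp (φ x) ((hτ h).sub contDiffAt_const)
  have hX : IsLocalDiffeomorphAt 𝓘(ℂ, E) 𝓘(ℂ, E) ω X (φ x) := by
    refine hXs.contMDiffAt.isLocalDiffeomorphAt (by simp) (by simp) ?_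
    rw [mfderiv_eq_fderiv, hXd.fderiv]
    exact Function.bijective_id
  refine ⟨ρ, χ, fun k y => ?_, ?_, ?_⟩
  · simp only [χ, map_smul, map_sum]
    congr 1
    rw [← Equiv.sum_comp (Equiv.mulRight k) fun h => ρ k (ρ h⁻¹ (φ (h • y) - φ x))]
    refine Finset.sum_congr rfl fun h _ => ?_
    rw [Equiv.coe_mulRight, mul_inv_rev, mul_smul, map_mul, ← mul_apply_eq_comp,
      ← mul_assoc, ← map_mul, mul_inv_cancel, map_one, one_mul]
  · simp [χ, hx]
  · have h1 := (isLocalDiffeomorphAt_extChartAt (I := 𝓘(ℂ, E)) (n := ω) x).comp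
      (K := 𝓘(ℂ, E)) (P := E) hX
    refine h1.congr_of_eventuallyEq ?_
    filter_upwards [extChartAt_source_mem_nhds (I := 𝓘(ℂ, E)) x] with y hy
    simp only [χ, X, τ, Function.comp_apply]
    rw [φ.left_inv hy]

end Linearization

/-! ### Local diffeomorphisms into open subsets -/

section Opens

open Set Filter

variable {𝕜 : Type*} [NontriviallyNormedField 𝕜]
  {E : Type*} [NormedAddCommGroup E] [NormedSpace 𝕜 E]
  {F : Type*} [NormedAddCommGroup F] [NormedSpace 𝕜 F]
  {H : Type*} [TopologicalSpace H] {H' : Type*} [TopologicalSpace H']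
  {I : ModelWithCorners 𝕜 E H} {J : ModelWithCorners 𝕜 F H'}
  {M : Type*} [TopologicalSpace M] [ChartedSpace H M]
  {N : Type*} [TopologicalSpace N] [ChartedSpace H' N] {n : WithTop ℕ∞}

theorem IsLocalDiffeomorphAt.of_subtypeVal_comp {U : TopologicalSpace.Opens N} {f : M → U} {x : M}
    (hf : IsLocalDiffeomorphAt I J n (Subtype.val ∘ f) x) : IsLocalDiffeomorphAt I J n f x := by
  let e := U.openPartialHomeomorphSubtypeCoe ⟨f x⟩
  have hsymm : ∀ y ∈ U, ((e.symm y : U) : N) = y := fun y hy =>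
    e.right_inv (by rw [U.openPartialHomeomorphSubtypeCoe_target]; exact hy)
  have he : IsLocalDiffeomorphAt J J n e (f x) := by
    refine e.isLocalDiffeomorphAt (by simp [e]) (Eventually.of_forall fun y => ?_) ?_
    · exact contMDiff_subtype_val y
    · filter_upwards [U.isOpen.mem_nhds (f x).2] with y hy
      change ContMDiffWithinAt J J n e.symm univ y
      refine (ChartedSpace.liftPropWithinAt_subtypeVal_comp_iff ..).1 ?_
      change ContMDiffAt J J n (Subtype.val ∘ e.symm) y
      refine contMDiffAt_id.congr_of_eventuallyEq ?_
      filter_upwards [U.isOpen.mem_nhds hy] with z hz using hsymm z hz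
  have hes := e.isLocalDiffeomorphAt_symm (by simp [e]) he
  refine (hf.comp (K := J) (P := U) hes).congr_of_eventuallyEq (Eventually.of_forall fun y => ?_)
  exact Subtype.ext (hsymm _ (f y).2).symm

end Opens

/-! ### The twisted product and its map to the saturation -/

section TwistedProduct

open Set Filter

variable {G M : Type*} [Group G] [MulAction G M] {H : Subgroup G}

theorem toSaturation_surjective (S : SubMulAction H M) : Function.Surjective (toSaturation S) := by
  rintro ⟨_, g, s, hs, rfl⟩
  exact ⟨(g, ⟨s, hs⟩), rfl⟩

/-- The map `G ×^H S → GS` induced by the action. -/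
def TwistedProduct.toSaturation (S : SubMulAction H M) : TwistedProduct S → saturation S :=
  Quotient.lift (_root_.toSaturation S) <| by
    rintro p _ ⟨h, rfl⟩
    exact Subtype.ext (by simp [_root_.toSaturation, mul_smul, Subgroup.smul_def])

theorem TwistedProduct.toSaturation_surjective (S : SubMulAction H M) :
    Function.Surjective (TwistedProduct.toSaturation S) := fun y =>
  let ⟨p, hp⟩ := _root_.toSaturation_surjective S y
  ⟨TwistedProduct.mk S p, hp⟩

variable {S : SubMulAction H M}

theorem TwistedProduct.toSaturation_injective
    (hS : ∀ (g : G) (s t : S), g • (s : M) = t → g ∈ H) :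
    Function.Injective (TwistedProduct.toSaturation S) := by
  intro p q hpq
  obtain ⟨⟨g, s⟩, rfl⟩ := TwistedProduct.mk_surjective S p
  obtain ⟨⟨g', s'⟩, rfl⟩ := TwistedProduct.mk_surjective S q
  have h1 : g • (s : M) = g' • (s' : M) := congrArg Subtype.val hpq
  have h2 : (g'⁻¹ * g) • (s : M) = s' := by rw [mul_smul, h1, inv_smul_smul]
  refine (TwistedProduct.mk_eq_mk_iff S _ _).2 ⟨⟨g'⁻¹ * g, hS _ _ _ h2⟩, ?_⟩
  refine Prod.ext ?_ (Subtype.ext h2.symm)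
  simp

/-- The fibres of `G × S → GS` are torsors under `H`. -/
theorem card_preimage_toSaturation (hS : ∀ (g : G) (s t : S), g • (s : M) = t → g ∈ H)
    (y : saturation S) : Nat.card (toSaturation S ⁻¹' {y}) = Nat.card H := by
  obtain ⟨⟨g, s⟩, rfl⟩ := toSaturation_surjective S y
  refine (Nat.card_congr (Equiv.ofBijective (fun h : H =>
    (⟨(g * (h : G)⁻¹, h • s), ?_⟩ : toSaturation S ⁻¹' {toSaturation S (g, s)})) ⟨?_, ?_⟩)).symm
  · exact Subtype.ext (by simp [toSaturation, mul_smul, Subgroup.smul_def])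
  · intro h k hk
    simpa using congrArg (fun p => (Subtype.val p).1) hk
  · rintro ⟨p, hp⟩
    have h1 : TwistedProduct.mk S (g, s) = TwistedProduct.mk S p :=
      TwistedProduct.toSaturation_injective hS hp.symm
    obtain ⟨h, rfl⟩ := (TwistedProduct.mk_eq_mk_iff S _ _).1 h1
    exact ⟨h, rfl⟩

theorem TwistedProduct.isClosedMap_mk [TopologicalSpace G] [IsTopologicalGroup G]
    [TopologicalSpace M] [ContinuousConstSMul G M] [Finite H] (S : SubMulAction H M) :
    IsClosedMap (TwistedProduct.mk S) := by
  intro U hU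
  rw [← isOpen_compl_iff]
  change IsOpen (TwistedProduct.mk S ⁻¹' (TwistedProduct.mk S '' U)ᶜ)
  rw [preimage_compl, isOpen_compl_iff]
  have key : TwistedProduct.mk S ⁻¹' (TwistedProduct.mk S '' U) =
      ⋃ h : H, (fun p : G × S => ((p.1 * (h : G)⁻¹, h • p.2) : G × S)) ⁻¹' U := by
    ext p
    simp only [mem_preimage, mem_image, mem_iUnion]
    constructor
    · rintro ⟨q, hq, hqp⟩
      obtain ⟨h, rfl⟩ := (TwistedProduct.mk_eq_mk_iff S p q).1 hqp.symm
      exact ⟨h, hq⟩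
    · rintro ⟨h, hh⟩
      exact ⟨_, hh, ((TwistedProduct.mk_eq_mk_iff S p _).2 ⟨h, rfl⟩).symm⟩
  rw [key]
  refine isClosed_iUnion_of_finite fun h => hU.preimage ?_
  refine (continuous_fst.mul continuous_const).prodMk (Continuous.subtype_mk ?_ _)
  exact (continuous_const_smul (h : G)).comp (continuous_subtype_val.comp continuous_snd)

/-- A closed local homeomorphism with finite fibres from a Hausdorff space is a covering; the fibres
are `H`-orbits. -/
theorem TwistedProduct.isCoveringMap_mk [TopologicalSpace G] [IsTopologicalGroup G] [T2Space G]
    [TopologicalSpace M] [T2Space M] [ContinuousConstSMul G M] [Finite H] (S : SubMulAction H M) :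
    IsCoveringMap (TwistedProduct.mk S) := by
  rw [isCoveringMap_iff_isCoveringMapOn_univ]
  refine (TwistedProduct.isClosedMap_mk S).isCoveringMapOn_of_isLocalHomeomorphOn (fun y _ => ?_)
    fun p _ => TwistedProduct.isLocalHomeomorph_mk S p
  obtain ⟨p, rfl⟩ := TwistedProduct.mk_surjective S y
  refine (finite_range fun h : H => ((p.1 * (h : G)⁻¹, h • p.2) : G × S)).subset fun q hq => ?_
  obtain ⟨h, rfl⟩ := (TwistedProduct.mk_eq_mk_iff S p q).1 (Eq.symm hq)
  exact ⟨h, rfl⟩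

variable {EG : Type*} [NormedAddCommGroup EG] [NormedSpace ℂ EG]
  {EM : Type*} [NormedAddCommGroup EM] [NormedSpace ℂ EM]
  {F : Type*} [NormedAddCommGroup F] [NormedSpace ℂ F]
  [TopologicalSpace G] [T2Space G] [ChartedSpace EG G] [LieGroup 𝓘(ℂ, EG) ω G]
  [TopologicalSpace M] [T2Space M] [ChartedSpace EM M]
  [ContinuousConstSMul G M] [Finite H]
  [ChartedSpace F S] [IsManifold 𝓘(ℂ, F) ω S]

/-- If the action map `G × S → M` is a local biholomorphism and `H` contains all elements that move
a point of `S` into `S`, then `G ×^H S` is a manifold, biholomorphic to the open set `GS`. -/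
theorem TwistedProduct.exists_diffeomorph
    (ha : IsLocalDiffeomorph (𝓘(ℂ, EG).prod 𝓘(ℂ, F)) 𝓘(ℂ, EM) ω
      (fun p : G × S => p.1 • (p.2 : M)))
    (hS : ∀ (g : G) (s t : S), g • (s : M) = t → g ∈ H) :
    IsManifold (𝓘(ℂ, EG).prod 𝓘(ℂ, F)) ω (TwistedProduct S) ∧
    IsLocalDiffeomorph (𝓘(ℂ, EG).prod 𝓘(ℂ, F)) (𝓘(ℂ, EG).prod 𝓘(ℂ, F)) ω
      (TwistedProduct.mk S) ∧
    (∃ (hGS : IsOpen (saturation S))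
      (Φ : Diffeomorph (𝓘(ℂ, EG).prod 𝓘(ℂ, F)) 𝓘(ℂ, EM) (TwistedProduct S)
        (⟨saturation S, hGS⟩ : TopologicalSpace.Opens M) ω),
      ∀ (g : G) (s : S), (Φ (TwistedProduct.mk S (g, s)) : M) = g • (s : M)) ∧
    IsCoveringMap (_root_.toSaturation S) ∧
    ∀ y : saturation S, Nat.card (_root_.toSaturation S ⁻¹' {y}) = Nat.card H := by
  have : IsTopologicalGroup G := topologicalGroup_of_lieGroup 𝓘(ℂ, EG) ω
  have hf := TwistedProduct.isLocalHomeomorph_mk S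
  have hs := TwistedProduct.mk_surjective S
  have hGS : IsOpen (saturation S) := by
    have h1 : saturation S = range (fun p : G × S => p.1 • (p.2 : M)) := by
      ext y
      constructor
      · rintro ⟨g, s, hs, rfl⟩
        exact ⟨(g, ⟨s, hs⟩), rfl⟩
      · rintro ⟨p, rfl⟩
        exact ⟨p.1, p.2, p.2.2, rfl⟩
    rw [h1]
    exact ha.isOpen_range
  let U : TopologicalSpace.Opens M := ⟨saturation S, hGS⟩
  let a : G × S → U := _root_.toSaturation S
  let Φ : TwistedProduct S → U := TwistedProduct.toSaturation S
  have ha' : IsLocalDiffeomorph (𝓘(ℂ, EG).prod 𝓘(ℂ, F)) 𝓘(ℂ, EM) ω a := fun p =>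
    IsLocalDiffeomorphAt.of_subtypeVal_comp (ha p)
  have hΦ : ∀ p, Φ (TwistedProduct.mk S p) = a p := fun p => rfl
  have h1 : IsManifold (𝓘(ℂ, EG).prod 𝓘(ℂ, F)) ω (TwistedProduct S) :=
    hf.isManifold_chartedSpace hs ha' hΦ
  have h2 : IsLocalDiffeomorph (𝓘(ℂ, EG).prod 𝓘(ℂ, F)) (𝓘(ℂ, EG).prod 𝓘(ℂ, F)) ω
      (TwistedProduct.mk S) := hf.isLocalDiffeomorph_chartedSpace hs ha' hΦ
  have h3 : IsLocalDiffeomorph (𝓘(ℂ, EG).prod 𝓘(ℂ, F)) 𝓘(ℂ, EM) ω Φ :=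
    hf.isLocalDiffeomorph_factor_chartedSpace hs ha' hΦ
  have hbij : Function.Bijective Φ := ⟨TwistedProduct.toSaturation_injective hS,
    TwistedProduct.toSaturation_surjective S⟩
  let D := h3.diffeomorphOfBijective hbij
  have hD : ∀ y, D y = Φ y := fun y => rfl
  refine ⟨h1, h2, ⟨hGS, D, fun g s => ?_⟩, ?_, card_preimage_toSaturation hS⟩
  · rw [hD]
    rfl
  · exact (TwistedProduct.isCoveringMap_mk S).homeomorph_comp D.toHomeomorph

end TwistedProduct

/-! ### Properness and the transversal to the orbit -/

section Slice

open Set Filter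

/-- For a proper action, elements that move a point near `x` to a point near `x` are close to the
stabilizer of `x`. -/
theorem exists_nhds_forall_smul_mem {G M : Type*} [Group G] [TopologicalSpace G]
    [IsTopologicalGroup G] [TopologicalSpace M] [T2Space M] [MulAction G M] [ProperSMul G M] (x : M)
    {V : Set G} (hV : V ∈ 𝓝 1) :
    ∃ N ∈ 𝓝 x, ∀ g : G, ∀ y ∈ N, g • y ∈ N → ∃ h ∈ MulAction.stabilizer G x, g * h⁻¹ ∈ V := by
  obtain ⟨U, hUV, hU, h1U⟩ := mem_nhds_iff.1 hV
  -- `W` is the set of pairs whose group element is already close to the stabilizer. Properness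
  -- makes the image of its complement closed, and this image misses `(x, x)`, hence a whole box
  -- around it.
  let W : Set (G × M) := ⋃ h ∈ MulAction.stabilizer G x, (fun p : G × M => p.1 * h⁻¹) ⁻¹' U
  have hW : IsOpen W := isOpen_biUnion fun h _ =>
    hU.preimage (continuous_fst.mul continuous_const)
  have hcl := (ProperSMul.isProperMap_smul_pair (G := G) (X := M)).isClosedMap _ hW.isClosed_compl
  have hx : (x, x) ∈ ((fun p : G × M => (p.1 • p.2, p.2)) '' Wᶜ)ᶜ := by
    rintro ⟨⟨g, y⟩, hgy, h⟩
    obtain ⟨h1, rfl⟩ := Prod.mk.inj h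
    refine hgy (mem_biUnion (x := g) h1 ?_)
    simpa using h1U
  obtain ⟨A, B, hA, hB, hxA, hxB, hAB⟩ := isOpen_prod_iff.1 hcl.isOpen_compl x x hx
  refine ⟨A ∩ B, inter_mem (hA.mem_nhds hxA) (hB.mem_nhds hxB), fun g y hy hgy => ?_⟩
  have h1 : (g, y) ∈ W := by
    by_contra h
    exact hAB (mk_mem_prod hgy.1 hy.2) ⟨(g, y), h, rfl⟩
  obtain ⟨h, hh, hgh⟩ := mem_iUnion₂.1 h1
  exact ⟨h, hh, hUV hgh⟩

/-- A neighbourhood of `0` contains a convex open neighbourhood that is invariant under a given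
finite group of linear maps. -/
theorem exists_convex_invariant_subset {H : Type*} [Group H] [Finite H] {E : Type*}
    [NormedAddCommGroup E] [NormedSpace ℂ E] (ρ : H →* (E →L[ℂ] E)) {Q : Set E} (hQ : Q ∈ 𝓝 0) :
    ∃ B ⊆ Q, IsOpen B ∧ Convex ℝ B ∧ 0 ∈ B ∧ ∀ h, ∀ v ∈ B, ρ h v ∈ B := by
  obtain ⟨ε, hε, hεQ⟩ := Metric.mem_nhds_iff.1 hQ
  refine ⟨⋂ h : H, ρ h ⁻¹' Metric.ball 0 ε, fun v hv => hεQ ?_, ?_, ?_, ?_, fun h v hv => ?_⟩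
  · simpa using mem_iInter.1 hv 1
  · exact isOpen_iInter_of_finite fun h => Metric.isOpen_ball.preimage (ρ h).continuous
  · exact convex_iInter fun h =>
      (convex_ball (0 : E) ε).is_linear_preimage ((ρ h).restrictScalars ℝ).isLinear
  · simp [hε]
  · rw [mem_iInter] at hv ⊢
    intro k
    have := hv (k * h)
    rwa [map_mul] at this

variable {EG : Type*} [NormedAddCommGroup EG] [NormedSpace ℂ EG] [FiniteDimensional ℂ EG]
  {EM : Type*} [NormedAddCommGroup EM] [NormedSpace ℂ EM] [FiniteDimensional ℂ EM]
  {G : Type*} [Group G] [TopologicalSpace G] [T2Space G] [ChartedSpace EG G]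
  [LieGroup 𝓘(ℂ, EG) ω G]
  {M : Type*} [TopologicalSpace M] [ChartedSpace EM M] [IsManifold 𝓘(ℂ, EM) ω M]
  [MulAction G M] [ContMDiffSMul 𝓘(ℂ, EG) 𝓘(ℂ, EM) ω G M]

/-- At a point `x` with finite stabilizer there are a linearizing chart `e` and an invariant
subspace `F` such that, near `x`, every orbit meets `e⁻¹(F)` transversally. -/
theorem exists_transversal_chart (x : M) [Finite (MulAction.stabilizer G x)] :
    ∃ (ρ : MulAction.stabilizer G x →* (EM →L[ℂ] EM)) (χ : M → EM) (F : Submodule ℂ EM)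
      (e : OpenPartialHomeomorph M EM),
      (∀ h y, χ (h • y) = ρ h (χ y)) ∧ χ x = 0 ∧ (∀ h, ∀ w ∈ F, ρ h w ∈ F) ∧
      e ∈ IsManifold.maximalAtlas 𝓘(ℂ, EM) ω M ∧ x ∈ e.source ∧ EqOn χ e e.source ∧
      IsLocalDiffeomorphAt (𝓘(ℂ, EG).prod 𝓘(ℂ, F)) 𝓘(ℂ, EM) ω
        (fun p : G × F => p.1 • e.symm (p.2 : EM)) (1, 0) := by
  have : CompleteSpace EG := FiniteDimensional.complete ℂ EG
  have : CompleteSpace EM := FiniteDimensional.complete ℂ EM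
  have : IsTopologicalGroup G := topologicalGroup_of_lieGroup 𝓘(ℂ, EG) ω
  have : ContinuousSMul G M := ContMDiffSMul.continuousSMul (I := 𝓘(ℂ, EG)) (I' := 𝓘(ℂ, EM)) ω
  obtain ⟨ρ, χ, hχ, hχx, hχd⟩ := exists_linearizing_chart (H := MulAction.stabilizer G x) (E := EM)
    (fun h => ContMDiffSMul.contMDiff_const_smul (I := 𝓘(ℂ, EG)) (h : G)) x fun h => h.2
  obtain ⟨Φ, hxΦ, hΦ⟩ := hχd
  let e := Φ.toOpenPartialHomeomorph
  have heM : e ∈ IsManifold.maximalAtlas 𝓘(ℂ, EM) ω M :=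
    e.mem_maximalAtlas_of_contMDiffOn Φ.contMDiffOn_toFun Φ.contMDiffOn_invFun
  have hxe : x ∈ e.source := hxΦ
  have heχ : EqOn χ e e.source := hΦ
  have hex : e x = 0 := by rw [← heχ hxe, hχx]
  have he0 : (0 : EM) ∈ e.target := by rw [← hex]; exact e.map_source hxe
  have hes0 : e.symm 0 = x := by rw [← hex, e.left_inv hxe]
  have hed : IsLocalDiffeomorphAt 𝓘(ℂ, EM) 𝓘(ℂ, EM) ω χ ((1 : G) • x) := by
    rw [one_smul]
    exact ⟨Φ, hxΦ, hΦ⟩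
  let o : G → EM := fun g => χ (g • x)
  have ho : ContMDiffAt 𝓘(ℂ, EG) 𝓘(ℂ, EM) ω o 1 :=
    hed.contMDiffAt.comp (1 : G) (contMDiff_smul_left x).contMDiffAt
  let A : EG →L[ℂ] EM := mfderiv 𝓘(ℂ, EG) 𝓘(ℂ, EM) o 1
  have hA : Function.Injective A := by
    have h1 : mfderiv 𝓘(ℂ, EG) 𝓘(ℂ, EM) o 1 = _ :=
      mfderiv_comp (1 : G) (hed.mdifferentiableAt (by simp))
        ((contMDiff_smul_left x).mdifferentiableAt (by simp))
    have h2 := (hed.mfderivToContinuousLinearEquiv (by simp)).injective.comp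
      (injective_mfderiv_smul (EG := EG) (EM := EM) x)
    change Function.Injective (mfderiv 𝓘(ℂ, EG) 𝓘(ℂ, EM) o 1)
    rw [h1]
    exact h2
  let W : Submodule ℂ EM := LinearMap.range (A : EG →ₗ[ℂ] EM)
  have hW : ∀ h, ∀ w ∈ W, ρ h w ∈ W := by
    rintro h _ ⟨v, rfl⟩
    -- As `h` fixes `x`, conjugation by `h` on `G` corresponds to `ρ h` under the orbit map;
    -- differentiating at `1` shows that `ρ h` preserves the range of `A`.
    let c : G → G := fun g => h * g * (h : G)⁻¹
    have hc : ContMDiff 𝓘(ℂ, EG) 𝓘(ℂ, EG) ω c :=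
      (contMDiff_const.mul contMDiff_id).mul contMDiff_const
    have hc1 : c 1 = 1 := by simp [c]
    have hoc : o ∘ c = ρ h ∘ o := by
      funext g
      have hx : (h : G)⁻¹ • x = x := (h⁻¹).2
      simp only [o, c, Function.comp_apply, mul_smul, hx]
      exact hχ h (g • x)
    let D : (G → EM) → EG →L[ℂ] EM := fun f => mfderiv 𝓘(ℂ, EG) 𝓘(ℂ, EM) f 1
    let Dc : EG →L[ℂ] EG := mfderiv 𝓘(ℂ, EG) 𝓘(ℂ, EG) c 1
    have h1 : D (o ∘ c) = A.comp Dc :=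
      (mfderiv_comp_of_eq (ho.mdifferentiableAt (by simp))
        (hc.mdifferentiableAt (by simp)) hc1).trans (by rw [hc1]; rfl)
    have h2 : D (ρ h ∘ o) = (ρ h).comp A :=
      (mfderiv_comp (1 : G) (I' := 𝓘(ℂ, EM)) (g := ρ h)
        (ρ h).differentiableAt.mdifferentiableAt (ho.mdifferentiableAt (by simp))).trans (by
          rw [mfderiv_eq_fderiv, (ρ h).fderiv]; rfl)
    refine ⟨Dc v, ?_⟩
    have h3 := DFunLike.congr_fun (h1.symm.trans ((congrArg D hoc).trans h2)) v
    exact h3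
  obtain ⟨F, hWF, hF⟩ := exists_isCompl_invariant
    ((ContinuousLinearMap.toLinearMapRingHom : (EM →L[ℂ] EM) →+* _).toMonoidHom.comp ρ) W hW
  refine ⟨ρ, χ, F, e, hχ, hχx, hF, heM, hxe, heχ, ?_⟩
  -- Read through `χ`, the action map has derivative `(v, w) ↦ A v + w` at `(1, 0)`, bijective
  -- because `A` is injective with range `W` complementary to `F`.
  let c : G × F → EM := fun p => χ (p.1 • e.symm (p.2 : EM))
  have hcd : IsLocalDiffeomorphAt (𝓘(ℂ, EG).prod 𝓘(ℂ, F)) 𝓘(ℂ, EM) ω c (1, 0) := by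
    have hcs : ContMDiffAt (𝓘(ℂ, EG).prod 𝓘(ℂ, F)) 𝓘(ℂ, EM) ω c (1, 0) := by
      have h1 : ContMDiffAt (𝓘(ℂ, EG).prod 𝓘(ℂ, F)) 𝓘(ℂ, EM) ω
          (fun p : G × F => (p.2 : EM)) (1, 0) :=
        (F.subtypeL.contDiff.contMDiff.comp contMDiff_snd).contMDiffAt
      have h2 : ContMDiffAt (𝓘(ℂ, EG).prod 𝓘(ℂ, F)) 𝓘(ℂ, EM) ω
          (fun p : G × F => e.symm (p.2 : EM)) (1, 0) :=
        ContMDiffAt.comp (g := e.symm) (I' := 𝓘(ℂ, EM)) (1, 0)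
          ((contMDiffOn_symm_of_mem_maximalAtlas heM).contMDiffAt (e.open_target.mem_nhds he0)) h1
      refine ContMDiffAt.comp (g := χ) (I' := 𝓘(ℂ, EM)) (1, 0) ?_ (contMDiffAt_fst.smul h2)
      change ContMDiffAt 𝓘(ℂ, EM) 𝓘(ℂ, EM) ω χ ((1 : G) • e.symm 0)
      rw [hes0]
      exact hed.contMDiffAt
    refine hcs.isLocalDiffeomorphAt (by simp) (by simp) ?_
    have hc1 : (fun z : G => c (z, 0)) = o := by
      funext z
      simp only [c, o, Submodule.coe_zero, hes0]
    have hc2 : (fun w : F => c (1, w)) =ᶠ[𝓝 0] F.subtypeL := by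
      have h1 : ∀ᶠ w : F in 𝓝 0, (w : EM) ∈ e.target :=
        continuous_subtype_val.continuousAt.preimage_mem_nhds (e.open_target.mem_nhds he0)
      filter_upwards [h1] with w hw
      simp only [c, one_smul]
      rw [heχ (e.map_target hw), e.right_inv hw]
      rfl
    let D1 : (G → EM) → EG →L[ℂ] EM := fun f => mfderiv 𝓘(ℂ, EG) 𝓘(ℂ, EM) f 1
    let D2 : (F → EM) → F →L[ℂ] EM := fun f => mfderiv 𝓘(ℂ, F) 𝓘(ℂ, EM) f 0
    have hD1 : D1 (fun z : G => c (z, 0)) = A := congrArg D1 hc1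
    have hD2 : D2 (fun w : F => c (1, w)) = F.subtypeL := by
      change mfderiv 𝓘(ℂ, F) 𝓘(ℂ, EM) (fun w : F => c (1, w)) 0 = _
      rw [mfderiv_eq_fderiv, hc2.fderiv_eq, F.subtypeL.fderiv]
    let D : EG × F →L[ℂ] EM := mfderiv (𝓘(ℂ, EG).prod 𝓘(ℂ, F)) 𝓘(ℂ, EM) c (1, 0)
    have hd : ∀ v : EG × F, D v = A v.1 + (v.2 : EM) := by
      intro v
      have h1 : D v = D1 (fun z : G => c (z, 0)) v.1 + D2 (fun w : F => c (1, w)) v.2 :=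
        mfderiv_prod_eq_add_apply (hcs.mdifferentiableAt (by simp))
      rw [h1, hD1, hD2]
      rfl
    change Function.Bijective D
    constructor
    · rw [injective_iff_map_eq_zero]
      intro v hv
      rw [hd] at hv
      have h1 : A v.1 = 0 := by
        refine (Submodule.disjoint_def.1 hWF.disjoint) _ ⟨v.1, rfl⟩ ?_
        have : A v.1 = -(v.2 : EM) := eq_neg_of_add_eq_zero_left hv
        change A v.1 ∈ F
        rw [this]
        exact F.neg_mem v.2.2
      rw [h1, zero_add] at hv
      exact Prod.ext (hA (h1.trans (map_zero A).symm)) (Subtype.ext hv)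
    · intro u
      have hu : u ∈ W ⊔ F := by rw [hWF.sup_eq_top]; trivial
      obtain ⟨_, ⟨v, rfl⟩, w, hw, hvw⟩ := Submodule.mem_sup.1 hu
      exact ⟨(v, ⟨w, hw⟩), (hd _).trans hvw⟩
  have hcx : c (1, 0) = e x := by
    simp only [c, Submodule.coe_zero, hes0, one_smul, hχx, hex]
  have hesd : IsLocalDiffeomorphAt 𝓘(ℂ, EM) 𝓘(ℂ, EM) ω e.symm (c (1, 0)) := by
    rw [hcx]
    exact e.isLocalDiffeomorphAt_symm hxe ⟨Φ, hxΦ, fun y _ => rfl⟩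
  refine (hcd.comp (K := 𝓘(ℂ, EM)) (P := M) hesd).congr_of_eventuallyEq ?_
  have hcont : ContinuousAt (fun p : G × F => p.1 • e.symm (p.2 : EM)) (1, 0) := by
    refine continuousAt_fst.smul (ContinuousAt.comp (g := e.symm) ?_
      (continuous_subtype_val.comp continuous_snd).continuousAt)
    exact e.symm.continuousAt he0
  have hnear : ∀ᶠ p : G × F in 𝓝 (1, 0), p.1 • e.symm (p.2 : EM) ∈ e.source := by
    refine hcont.preimage_mem_nhds (e.open_source.mem_nhds ?_)
    simpa [hes0] using hxe
  filter_upwards [hnear] with p hp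
  simp only [Function.comp_apply, c]
  rw [heχ hp, e.left_inv hp]

end Slice

/-! ### The slice as a submanifold, and the action map on it -/

section SliceManifold

open Set Filter

variable {EM : Type*} [NormedAddCommGroup EM] [NormedSpace ℂ EM] [FiniteDimensional ℂ EM]
  {M : Type*} [TopologicalSpace M] [ChartedSpace EM M]
  {F : Submodule ℂ EM} {X : Type*} [TopologicalSpace X] [Nonempty X] {ι : X → M} {κ : X → F}
  {e : OpenPartialHomeomorph M EM}

/-- A map which a chart `e` of `M` identifies with the inclusion of an open subset of a linear
subspace is a smooth embedding. -/
theorem isSmoothEmbedding_of_chart [IsManifold 𝓘(ℂ, EM) ω M]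
    (he : e ∈ IsManifold.maximalAtlas 𝓘(ℂ, EM) ω M) (hι : Topology.IsEmbedding ι)
    (hκ : Topology.IsOpenEmbedding κ) (hιe : ∀ s, ι s ∈ e.source) (hκe : ∀ s, (κ s : EM) = e (ι s)) :
    letI := hκ.singletonChartedSpace
    Manifold.IsSmoothEmbedding 𝓘(ℂ, F) 𝓘(ℂ, EM) ω ι := by
  let := hκ.singletonChartedSpace
  have : IsManifold 𝓘(ℂ, F) ω X := hκ.isManifold_singleton
  obtain ⟨W, hW⟩ := F.exists_isCompl
  -- Any linear complement of `F` gives the immersion normal form `w ↦ (w, 0)`; no invariance is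
  -- needed here.
  let L : (F × W) ≃L[ℂ] EM := (Submodule.prodEquivOfIsCompl F W hW).toContinuousLinearEquiv
  have hL : ∀ w : F, L (w, 0) = w := fun w => by
    simp [L]
  refine ⟨⟨W, inferInstance, inferInstance, fun s => ?_⟩, hι⟩
  refine Manifold.IsImmersionAtOfComplement.mk_of_charts L (chartAt F s) e (mem_chart_source F s)
    (hιe s) (IsManifold.chart_mem_maximalAtlas s) he (fun t _ => hιe t) fun u hu => ?_
  have hu' : u ∈ range κ := by
    have h1 : u ∈ (chartAt F s).target := by simpa using hu
    rwa [show chartAt F s = hκ.toOpenPartialHomeomorph κ from rfl,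
      hκ.toOpenPartialHomeomorph_target] at h1
  obtain ⟨t, rfl⟩ := hu'
  have h2 : (chartAt F s).symm (κ t) = t := hκ.toOpenPartialHomeomorph_left_inv
  simp only [Function.comp_apply, hL, OpenPartialHomeomorph.extend_coe,
    OpenPartialHomeomorph.extend_coe_symm, modelWithCornersSelf_coe, modelWithCornersSelf_coe_symm,
    id]
  rw [h2, hκe]

variable {EG : Type*} [NormedAddCommGroup EG] [NormedSpace ℂ EG]
  {G : Type*} [Group G] [TopologicalSpace G] [ChartedSpace EG G]
  [LieGroup 𝓘(ℂ, EG) ω G] [MulAction G M] [ContMDiffSMul 𝓘(ℂ, EG) 𝓘(ℂ, EM) ω G M]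

omit [FiniteDimensional ℂ EM] in
/-- By equivariance, an action map `G × X → M` is a local diffeomorphism if it is one along
`{1} × X`. -/
theorem isLocalDiffeomorph_smul_of_chart (hκ : Topology.IsOpenEmbedding κ)
    (hιe : ∀ s, e.symm (κ s) = ι s)
    (h : ∀ s, IsLocalDiffeomorphAt (𝓘(ℂ, EG).prod 𝓘(ℂ, F)) 𝓘(ℂ, EM) ω
      (fun p : G × F => p.1 • e.symm (p.2 : EM)) (1, κ s)) :
    letI := hκ.singletonChartedSpace
    IsLocalDiffeomorph (𝓘(ℂ, EG).prod 𝓘(ℂ, F)) 𝓘(ℂ, EM) ω (fun p : G × X => p.1 • ι p.2) := by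
  let := hκ.singletonChartedSpace
  have : IsManifold 𝓘(ℂ, F) ω X := hκ.isManifold_singleton
  rintro ⟨g, s⟩
  set b : G × F → M := fun p => p.1 • e.symm (p.2 : EM)
  let k := hκ.toOpenPartialHomeomorph κ
  have hk : k ∈ IsManifold.maximalAtlas 𝓘(ℂ, F) ω X := IsManifold.chart_mem_maximalAtlas s
  let K := (OpenPartialHomeomorph.refl G).prod k
  have hK : IsLocalDiffeomorphAt (𝓘(ℂ, EG).prod 𝓘(ℂ, F)) (𝓘(ℂ, EG).prod 𝓘(ℂ, F)) ω K (g, s) := by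
    refine K.isLocalDiffeomorphAt (by simp [K, k]) (Eventually.of_forall fun p => ?_) ?_
    · have h1 : ContMDiffAt 𝓘(ℂ, F) 𝓘(ℂ, F) ω k p.2 :=
        contMDiffAt_of_mem_maximalAtlas hk (by simp [k])
      exact contMDiffAt_fst.prodMk (h1.comp p contMDiffAt_snd)
    · filter_upwards [K.open_target.mem_nhds (K.map_source (x := (g, s)) (by simp [K, k]))] with p hp
      have h1 : ContMDiffAt 𝓘(ℂ, F) 𝓘(ℂ, F) ω k.symm p.2 :=
        contMDiffAt_symm_of_mem_maximalAtlas hk hp.2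
      exact contMDiffAt_fst.prodMk (h1.comp p contMDiffAt_snd)
  have hKg : K (g, s) = (g, κ s) := rfl
  -- Since `b` intertwines left translation on `G` with the action on `M`, its behaviour at `(g, κ
  -- s)` reduces to that at `(1, κ s)`.
  let D := (Diffeomorph.smul 𝓘(ℂ, EG) 𝓘(ℂ, EG) ω (g⁻¹ : G) (M := G)).prodCongr
    (Diffeomorph.refl 𝓘(ℂ, F) F ω)
  have hD : ∀ p : G × F, D p = (g⁻¹ * p.1, p.2) := fun p => rfl
  have hb : IsLocalDiffeomorphAt (𝓘(ℂ, EG).prod 𝓘(ℂ, F)) 𝓘(ℂ, EM) ω b (g, κ s) := by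
    have h1 := (D.isLocalDiffeomorph (g, κ s)).comp (K := 𝓘(ℂ, EM)) (P := M) (g := b) (by
      rw [hD, inv_mul_cancel]
      exact h s)
    have h2 := h1.comp (K := 𝓘(ℂ, EM)) (P := M)
      ((Diffeomorph.smul 𝓘(ℂ, EG) 𝓘(ℂ, EM) ω g (M := M)).isLocalDiffeomorph _)
    refine h2.congr_of_eventuallyEq (Eventually.of_forall fun p => ?_)
    simp only [Function.comp_apply, hD, b, Diffeomorph.smul_apply, smul_smul, mul_inv_cancel_left]
  refine (hK.comp (K := 𝓘(ℂ, EM)) (P := M) (g := b) (by rw [hKg]; exact hb)).congr_of_eventuallyEq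
    (Eventually.of_forall fun p => ?_)
  exact congrArg (p.1 • ·) (hιe p.2).symm

end SliceManifold

/-! ### Construction of the slice -/

theorem mainTheorem8
    {EG : Type*} [NormedAddCommGroup EG] [NormedSpace ℂ EG] [FiniteDimensional ℂ EG]
    {EM : Type*} [NormedAddCommGroup EM] [NormedSpace ℂ EM] [FiniteDimensional ℂ EM]
    -- `G` is a complex Lie group
    {G : Type*} [Group G] [TopologicalSpace G] [T2Space G] [ChartedSpace EG G]
    [LieGroup 𝓘(ℂ, EG) ω G]
    -- `M` is a complex manifold
    {M : Type*} [TopologicalSpace M] [T2Space M] [ChartedSpace EM M] [IsManifold 𝓘(ℂ, EM) ω M]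
    -- `G` acts holomorphically and properly on `M`
    [MulAction G M] [ContMDiffSMul 𝓘(ℂ, EG) 𝓘(ℂ, EM) ω G M] [ProperSMul G M]
    (x : M) [Finite (MulAction.stabilizer G x)] :
    -- `S` is a `G_x`-invariant subset of `M` with a complex structure modelled on `F`
    ∃ (S : SubMulAction (MulAction.stabilizer G x) M) (F : Submodule ℂ EM) (_ : ChartedSpace F S),
      x ∈ S ∧
      -- `S` is a locally closed complex submanifold of `M`
      IsManifold 𝓘(ℂ, F) ω S ∧
      Manifold.IsSmoothEmbedding 𝓘(ℂ, F) 𝓘(ℂ, EM) ω (Subtype.val : S → M) ∧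
      IsLocallyClosed (S : Set M) ∧
      ContractibleSpace S ∧
      -- `G ×^{G_x} S` is a complex manifold, locally biholomorphic to `G × S`
      IsManifold (𝓘(ℂ, EG).prod 𝓘(ℂ, F)) ω (TwistedProduct S) ∧
      IsLocalDiffeomorph (𝓘(ℂ, EG).prod 𝓘(ℂ, F)) (𝓘(ℂ, EG).prod 𝓘(ℂ, F)) ω
        (TwistedProduct.mk S) ∧
      -- `GS` is open, and the action map induces a biholomorphism `G ×^{G_x} S → GS`
      (∃ (hGS : IsOpen (saturation S))
        (Φ : Diffeomorph (𝓘(ℂ, EG).prod 𝓘(ℂ, F)) 𝓘(ℂ, EM) (TwistedProduct S)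
          (⟨saturation S, hGS⟩ : TopologicalSpace.Opens M) ω),
        ∀ (g : G) (s : S), (Φ (TwistedProduct.mk S (g, s)) : M) = g • (s : M)) ∧
      -- `G × S → GS` is a covering map of degree `|G_x|`
      IsCoveringMap (toSaturation S) ∧
      ∀ y : saturation S,
        Nat.card (toSaturation S ⁻¹' {y}) = Nat.card (MulAction.stabilizer G x) := by

  have : IsTopologicalGroup G := topologicalGroup_of_lieGroup 𝓘(ℂ, EG) ω
  obtain ⟨ρ, χ, F, e, hχ, hχx, hF, heM, hxe, heχ, hb⟩ :=
    exists_transversal_chart (EG := EG) (EM := EM) (G := G) x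
  obtain ⟨Ψ, h0Ψ, hbΨ⟩ := hb
  set b : G × F → M := fun p => p.1 • e.symm (p.2 : EM)
  have hex : e x = 0 := by rw [← heχ hxe, hχx]
  -- On the box `V × D` the map `b` is injective; `V` then fixes how small `N` must be, and `D` how
  -- small the slice.
  obtain ⟨V, D, hV, hD, h1V, h0D, hVD⟩ := isOpen_prod_iff.1 Ψ.open_source 1 0 h0Ψ
  obtain ⟨D', hD', rfl⟩ := isOpen_induced_iff.1 hD
  have hinj : Set.InjOn b Ψ.source := fun p hp q hq hpq =>
    Ψ.injOn hp hq (by rwa [hbΨ hp, hbΨ hq] at hpq)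
  obtain ⟨N, hN, hproper⟩ := exists_nhds_forall_smul_mem x (hV.mem_nhds h1V)
  let H := MulAction.stabilizer G x
  -- an invariant neighbourhood of `x` in the chart domain
  let U : Set M := ⋂ h : H, (fun y => h • y) ⁻¹' (e.source ∩ interior N)
  have hUo : IsOpen U := isOpen_iInter_of_finite fun h =>
    (e.open_source.inter isOpen_interior).preimage (continuous_const_smul (h : G))
  have hxU : x ∈ U := Set.mem_iInter.2 fun h => by
    have : h • x = x := h.2
    rw [Set.mem_preimage, this]
    exact ⟨hxe, mem_interior_iff_mem_nhds.2 hN⟩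
  have hUe : U ⊆ e.source ∩ interior N := fun y hy => by simpa using Set.mem_iInter.1 hy 1
  have hUinv : ∀ h : H, ∀ y ∈ U, h • y ∈ U := fun h y hy => Set.mem_iInter.2 fun k => by
    rw [Set.mem_preimage, smul_smul]
    exact Set.mem_iInter.1 hy (k * h)
  have hUe' : U ⊆ e.source := fun y hy => (hUe hy).1
  have hQ : e '' U ∩ D' ∈ 𝓝 (0 : EM) := by
    refine Filter.inter_mem ?_ (hD'.mem_nhds h0D)
    rw [← hex]
    exact (e.isOpen_image_of_subset_source hUo hUe').mem_nhds ⟨x, hxU, rfl⟩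
  -- Inclusion in `e '' U` makes every point of `B ∩ F` come from the slice, inclusion in `D'` keeps
  -- it in the injectivity box, and convexity gives contractibility.
  obtain ⟨B, hBQ, hBo, hBc, hB0, hBinv⟩ := exists_convex_invariant_subset ρ hQ
  let S : SubMulAction H M :=
    { carrier := {y | y ∈ U ∧ χ y ∈ B ∧ χ y ∈ F}
      smul_mem' := fun h y hy => ⟨hUinv h y hy.1, by rw [hχ]; exact hBinv h _ hy.2.1,
        by rw [hχ]; exact hF h _ hy.2.2⟩ }
  have hxS : x ∈ S := ⟨hxU, by rwa [hχx], by rw [hχx]; exact F.zero_mem⟩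
  have : Nonempty S := ⟨⟨x, hxS⟩⟩
  have hSe : ∀ s : S, (s : M) ∈ e.source := fun s => hUe' s.2.1
  let κ : S → F := fun s => ⟨χ s, s.2.2.2⟩
  have hκe : ∀ s, (κ s : EM) = e s := fun s => heχ (hSe s)
  have hκs : ∀ s, e.symm (κ s) = s := fun s => by rw [hκe, e.left_inv (hSe s)]
  have hrange : Set.range κ = (fun w : F => (w : EM)) ⁻¹' B := by
    ext w
    constructor
    · rintro ⟨s, rfl⟩
      exact s.2.2.1
    · intro hw
      obtain ⟨y, hy, hyw⟩ := (hBQ hw).1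
      have hχy : χ y = w := (heχ (hUe' hy)).trans hyw
      exact ⟨⟨y, hy, by rw [hχy]; exact hw, by rw [hχy]; exact w.2⟩, Subtype.ext hχy⟩
  have hκ : Topology.IsOpenEmbedding κ := by
    refine ⟨?_, by rw [hrange]; exact hBo.preimage continuous_subtype_val⟩
    have h1 : Topology.IsEmbedding (fun s : S => (⟨s, hSe s⟩ : e.source)) :=
      Topology.IsEmbedding.of_comp (by fun_prop) continuous_subtype_val
        Topology.IsEmbedding.subtypeVal
    have h2 : Topology.IsEmbedding (Subtype.val ∘ κ) := by
      have h3 : Subtype.val ∘ κ = e.source.domRestrict e ∘ fun s : S => ⟨s, hSe s⟩ :=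
        funext hκe
      rw [h3]
      exact e.isOpenEmbedding_restrict.isEmbedding.comp h1
    refine Topology.IsEmbedding.of_comp ?_ continuous_subtype_val h2
    exact h2.continuous.subtype_mk _
  have hκD : ∀ s, (κ s : EM) ∈ D' := fun s => (hBQ s.2.2.1).2
  let := hκ.singletonChartedSpace
  have hSM : IsManifold 𝓘(ℂ, F) ω S := hκ.isManifold_singleton
  have hloc : IsLocalDiffeomorph (𝓘(ℂ, EG).prod 𝓘(ℂ, F)) 𝓘(ℂ, EM) ω
      (fun p : G × S => p.1 • (p.2 : M)) :=
    isLocalDiffeomorph_smul_of_chart hκ hκs fun s =>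
      ⟨Ψ, hVD (Set.mk_mem_prod h1V (hκD s)), hbΨ⟩
  have hmem : ∀ (g : G) (s t : S), g • (s : M) = t → g ∈ H := by
    intro g s t hgst
    obtain ⟨h, hh, hgh⟩ := hproper g s (interior_subset (hUe s.2.1).2)
      (by rw [hgst]; exact interior_subset (hUe t.2.1).2)
    -- Writing `g = (g h⁻¹) h` and absorbing `h` into the slice leaves two points of the box, `(g
    -- h⁻¹, κ s')` and `(1, κ t)`, with the same image under `b`.
    let s' : S := (⟨h, hh⟩ : H) • s
    have h1 : b (g * h⁻¹, κ s') = b (1, κ t) := by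
      simp only [b, hκs, one_smul]
      rw [← hgst]
      change (g * h⁻¹) • h • (s : M) = _
      rw [smul_smul, inv_mul_cancel_right]
    have h2 := hinj (hVD (Set.mk_mem_prod hgh (hκD s'))) (hVD (Set.mk_mem_prod h1V (hκD t))) h1
    have h3 : g * h⁻¹ = 1 := congrArg Prod.fst h2
    rw [mul_inv_eq_one.1 h3]
    exact hh
  refine ⟨S, F, inferInstance, hxS, hSM,
    isSmoothEmbedding_of_chart heM Topology.IsEmbedding.subtypeVal hκ hSe hκe, ?_, ?_,
    TwistedProduct.exists_diffeomorph hloc hmem⟩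
  · have h1 : IsOpen (U ∩ e ⁻¹' B) := by
      have := (e.isOpen_inter_preimage hBo).inter hUo
      rwa [Set.inter_right_comm, Set.inter_eq_right.2 hUe'] at this
    have h2 : IsOpen (U ∩ e ⁻¹' (F : Set EM)ᶜ) := by
      have := (e.isOpen_inter_preimage F.closed_of_finiteDimensional.isOpen_compl).inter hUo
      rwa [Set.inter_right_comm, Set.inter_eq_right.2 hUe'] at this
    -- Preimages under `e` are controlled only on its source, so the closed condition of lying in
    -- `F` is expressed as the complement of an open subset of `U`.
    refine ⟨U ∩ e ⁻¹' B, (U ∩ e ⁻¹' (F : Set EM)ᶜ)ᶜ, h1, h2.isClosed_compl, ?_⟩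
    ext y
    change (y ∈ U ∧ χ y ∈ B ∧ χ y ∈ F) ↔ _
    constructor
    · rintro ⟨hy, hyB, hyF⟩
      rw [heχ (hUe' hy)] at hyB hyF
      exact ⟨⟨hy, hyB⟩, fun h => h.2 hyF⟩
    · rintro ⟨⟨hy, hyB⟩, hyF⟩
      rw [heχ (hUe' hy)]
      exact ⟨hy, hyB, by_contra fun h => hyF ⟨hy, h⟩⟩
  · have hconv : Convex ℝ ((fun w : F => (w : EM)) ⁻¹' B) :=
      hBc.is_linear_preimage ((F.subtype).restrictScalars ℝ).isLinear
    have hc : ContractibleSpace (Set.range κ) := by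
      rw [hrange]
      exact hconv.contractibleSpace ⟨0, hB0⟩
    exact hκ.isEmbedding.toHomeomorph.contractibleSpace
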